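/- Let $\kappa,k,p,n$ be non-negative integers and $m$ an integer with $\kappa\ge 2k+2$, $k+1\le n\le\kappa$ and $-p+2k+1\le m\le\kappa-p-1$. Put $q=e^{\pi i/\kappa}$ and $q^{x}=e^{\pi i x/\kappa}$ for $x\in\mathbb C$. Then $$\Psi^{(k)}(q^{-1},-m-p+k,n-1)-\Psi^{(k)}(q^{-1},-m-p+k,-n-1)=P^{(k+1)}_{n-k-1}(m+p-k)\prod_{j=1}^{k}\left(q^{-n+2j}-q^{n}\right),$$ where the two sides are defined as follows. *Trace functions.* Let $q$ be $e^{\pi i/\kappa}$ or $e^{-\pi i/\kappa}$, and let $q^x$ be $e^{\pi i x/\kappa}$, respectively $e^{-\pi i x/\kappa}$. The quantum group $U_q(sl_2)$ has generators $E,F,q^{ch}$ ($c\in\mathbb C$) and relations $q^{0h}=1$, $q^{ch}q^{c'h}=q^{(c+c')h}$, $q^{ch}Eq^{-ch}=q^{2c}E$, $q^{ch}Fq^{-ch}=q^{-2c}F$, $EF-FE=\frac{q^h-q^{-h}}{q-q^{-1}}$, and comultiplication $\Delta(E)=E\otimes q^h+1\otimes E$, $\Delta(F)=F\otimes1+q^{-h}\otimes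 F$, $\Delta(q^{ch})=q^{ch}\otimes q^{ch}$. Let $M_\mu$ be the Verma module with highest weight $\mu$ and highest weight vector $v_\mu$, let $U$ be the irreducible module of highest weight $2k$ (of dimension $2k+1$), and let $U[0]$ be its one-dimensional zero weight space. For generic $\mu$ (that is, $q^{2(\mu-l)}\ne1$ for all integers $l\ge 0$) and $u\in U[0]$ let $\Phi^u_\mu:M_\mu\to M_\mu\otimes U$ be the intertwining operator with $\Phi_\mu^uv_\mu=v_\mu\otimes u+\sum_{j\ge1}F^jv_\mu\otimes u_j$, $u_j\in U$. For $|q^{-2\nu}|<1$ the series $\operatorname{Tr}|_{M_\mu}(\Phi_\mu^uq^{\nu h})\in U[0]$ converges; let $\psi^{(k)}(q,\nu,\mu)$ be the scalar by which it multiplies $u$. Then $\Psi^{(k)}(q,\nu,\mu)$ is the function defined by $$\Psi^{(k)}(q,\nu,\mu)=\prod_{j=1}^{k}\frac{q^{\mu+1-j}-q^{-\mu-1+j}}{q^{\nu+j}-q^{-\nu-j}}\;\psi^{(k)}(q,\nu,\mu)$$ for such $\mu,\nu$, and by analytic continuation otherwise: it is holomorphic in $\nu$ on the set where $q^{2(\nu-l)}\neq1$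 for all integers $l$ with $|l|\le k$ (for every $\mu$), and entire in $\mu$ (for every $\nu$ in this set). *Macdonald polynomials.* For an indeterminate $q$ and an integer $k\ge0$ the Macdonald polynomials $P^{(k)}_n(x)$, $n\ge 0$, of type $A_1$ are the Laurent polynomials in $q^x$ with coefficients in $\mathbb C(q)$, invariant under $x\mapsto-x$, such that $P_0^{(k)}=1$, $P_n^{(k)}(x)=q^{nx}+q^{-nx}+{}$lower order terms for $n>0$, and $\langle P^{(k)}_m,P^{(k)}_n\rangle=0$ for $m\ne n$, where $\langle f,g\rangle$ is one half of the constant term of $fg\prod_{j=0}^{k-1}(1-q^{2(j+x)})(1-q^{2(j-x)})$. The coefficients of $P^{(k+1)}_{n-k-1}$ have no pole at $q=e^{\pi i/\kappa}$ (this is part of the claim), and $P^{(k+1)}_{n-k-1}(m+p-k)$ above is the value at this $q$ and at $x=m+p-k$. -/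

import Mathlib

open scoped TensorProduct LaurentPolynomial

noncomputable section

namespace QuantumTrace

/-! Powers of `q` and `q`-numbers. The base is `q = exp η`, with the branch `q ^ x = exp (η x)`;
replacing `q` by `q⁻¹` means replacing `η` by `-η`. -/

/-- `q ^ x` for `q = exp η` and a complex exponent `x`. -/
def qpow (η x : ℂ) : ℂ := Complex.exp (η * x)

/-- The `q`-number `[x] = (q ^ x - q ^ (-x)) / (q - q ^ (-1))`. -/
def qnum (η x : ℂ) : ℂ := (qpow η x - qpow η (-x)) / (qpow η 1 - qpow η (-1))

theorem qpow_zero (η : ℂ) : qpow η 0 = 1 := by simp [qpow]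

theorem qpow_add (η x y : ℂ) : qpow η (x + y) = qpow η x * qpow η y := by
  simp [qpow, mul_add, Complex.exp_add]

theorem qnum_zero (η : ℂ) : qnum η 0 = 0 := by simp [qnum]

theorem qnum_commutator (η a b : ℂ) :
    qnum η (a + 1) * qnum η (b - a) - qnum η a * qnum η (b - a + 1) =
      (qpow η (b - 2 * a) - qpow η (-(b - 2 * a))) / (qpow η 1 - qpow η (-1)) := by
  by_cases h : qpow η 1 - qpow η (-1) = 0
  · simp [qnum, h]
  · have key : (qpow η (a + 1) - qpow η (-(a + 1))) * (qpow η (b - a) - qpow η (-(b - a))) -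
        (qpow η a - qpow η (-a)) * (qpow η (b - a + 1) - qpow η (-(b - a + 1))) =
        (qpow η (b - 2 * a) - qpow η (-(b - 2 * a))) * (qpow η 1 - qpow η (-1)) := by
      simp only [sub_mul, mul_sub, ← qpow_add]
      ring_nf
    rw [qnum, qnum, qnum, qnum, div_mul_div_comm, div_mul_div_comm, ← sub_div, key,
      mul_div_mul_right _ _ h]

/-! The quantum group `U_q(sl₂)`: a module over it is a vector space with operators
`E`, `F`, `q ^ (c h)` (`c ∈ ℂ`) subject to the defining relations. -/

/-- A structure of `U_q(sl₂)`-module on `V`; `K c` is the action of `q ^ (c h)`. -/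
structure UqModule (η : ℂ) (V : Type*) [AddCommGroup V] [Module ℂ V] where
  E : Module.End ℂ V
  F : Module.End ℂ V
  K : ℂ → Module.End ℂ V
  K_zero : K 0 = 1
  K_add : ∀ c d, K (c + d) = K c * K d
  K_E : ∀ c, K c * E * K (-c) = qpow η (2 * c) • E
  K_F : ∀ c, K c * F * K (-c) = qpow η (-(2 * c)) • F
  E_F : E * F - F * E = (qpow η 1 - qpow η (-1))⁻¹ • (K 1 - K (-1))

/-- Linear maps commuting with the actions of the generators. -/
def IsUqHom {η : ℂ} {V W : Type*} [AddCommGroup V] [Module ℂ V] [AddCommGroup W] [Module ℂ W]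
    (A : UqModule η V) (B : UqModule η W) (φ : V →ₗ[ℂ] W) : Prop :=
  φ ∘ₗ A.E = B.E ∘ₗ φ ∧ φ ∘ₗ A.F = B.F ∘ₗ φ ∧ ∀ c, φ ∘ₗ A.K c = B.K c ∘ₗ φ

section Tensor

variable {η : ℂ} {V W : Type*} [AddCommGroup V] [Module ℂ V] [AddCommGroup W] [Module ℂ W]

theorem UqModule.K_mul_neg (A : UqModule η V) (c : ℂ) : A.K c * A.K (-c) = 1 := by
  rw [← A.K_add, add_neg_cancel, A.K_zero]

theorem UqModule.K_neg_mul (A : UqModule η V) (c : ℂ) : A.K (-c) * A.K c = 1 := by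
  rw [← A.K_add, neg_add_cancel, A.K_zero]

theorem UqModule.K_comm (A : UqModule η V) (c d : ℂ) : A.K c * A.K d = A.K d * A.K c := by
  rw [← A.K_add, add_comm, A.K_add]

theorem UqModule.K_mul_E (A : UqModule η V) (c : ℂ) :
    A.K c * A.E = qpow η (2 * c) • (A.E * A.K c) := by
  rw [← smul_mul_assoc, ← A.K_E, mul_assoc, A.K_neg_mul, mul_one]

theorem UqModule.K_mul_F (A : UqModule η V) (c : ℂ) :
    A.K c * A.F = qpow η (-(2 * c)) • (A.F * A.K c) := by
  rw [← smul_mul_assoc, ← A.K_F, mul_assoc, A.K_neg_mul, mul_one]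

/-- The tensor product of two modules, for the comultiplication
`Δ E = E ⊗ q ^ h + 1 ⊗ E`, `Δ F = F ⊗ 1 + q ^ (-h) ⊗ F`, `Δ q ^ (c h) = q ^ (c h) ⊗ q ^ (c h)`. -/
def UqModule.tensor (A : UqModule η V) (B : UqModule η W) : UqModule η (V ⊗[ℂ] W) where
  E := TensorProduct.map A.E (B.K 1) + TensorProduct.map 1 B.E
  F := TensorProduct.map A.F 1 + TensorProduct.map (A.K (-1)) B.F
  K c := TensorProduct.map (A.K c) (B.K c)
  K_zero := by rw [A.K_zero, B.K_zero, TensorProduct.map_one]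
  K_add c d := by rw [A.K_add, B.K_add, TensorProduct.map_mul]
  K_E c := by
    simp only [mul_add, add_mul, ← TensorProduct.map_mul, A.K_E, B.K_E, mul_one, A.K_mul_neg]
    rw [B.K_comm c 1, mul_assoc, B.K_mul_neg, mul_one, TensorProduct.map_smul_left,
      TensorProduct.map_smul_right, smul_add]
  K_F c := by
    simp only [mul_add, add_mul, ← TensorProduct.map_mul, A.K_F, B.K_F, mul_one, B.K_mul_neg]
    rw [A.K_comm c (-1), mul_assoc, A.K_mul_neg, mul_one, TensorProduct.map_smul_left,
      TensorProduct.map_smul_right, smul_add]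
  E_F := by
    have hA : A.E * A.F = A.F * A.E + (qpow η 1 - qpow η (-1))⁻¹ • (A.K 1 - A.K (-1)) := by
      rw [← A.E_F]; abel
    have hB : B.E * B.F = B.F * B.E + (qpow η 1 - qpow η (-1))⁻¹ • (B.K 1 - B.K (-1)) := by
      rw [← B.E_F]; abel
    have h2 : TensorProduct.map (A.K (-1) * A.E) (B.F * B.K 1) =
        TensorProduct.map (A.E * A.K (-1)) (B.K 1 * B.F) := by
      rw [A.K_mul_E, B.K_mul_F, TensorProduct.map_smul_left, TensorProduct.map_smul_right]
      congr 2; norm_num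
    simp only [mul_add, add_mul, ← TensorProduct.map_mul, one_mul, mul_one, h2, hA, hB]
    simp only [TensorProduct.map_add_left, TensorProduct.map_add_right,
      TensorProduct.map_smul_left, TensorProduct.map_smul_right, sub_eq_add_neg, smul_add]
    simp only [← neg_one_smul ℂ (A.K (-1)), ← neg_one_smul ℂ (B.K (-1)),
      TensorProduct.map_smul_left, TensorProduct.map_smul_right]
    module

end Tensor

/-! The Verma module `M_μ`, with basis `F ^ i v_μ`, `i ≥ 0`. -/

/-- The Verma module of highest weight `μ` on the basis `e i = F ^ i v_μ`:
`F (e i) = e (i + 1)`, `E (e i) = [i] [μ - i + 1] e (i - 1)`,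
`q ^ (c h) (e i) = q ^ (c (μ - 2 i)) e i`. -/
def verma (η μ : ℂ) : UqModule η (ℕ →₀ ℂ) where
  E := Finsupp.lsum ℂ fun i : ℕ => (qnum η i * qnum η (μ - i + 1)) • Finsupp.lsingle (i - 1)
  F := Finsupp.lsum ℂ fun i : ℕ => Finsupp.lsingle (i + 1)
  K c := Finsupp.lsum ℂ fun i : ℕ => qpow η (c * (μ - 2 * i)) • Finsupp.lsingle i
  K_zero := by
    ext i : 2
    simp [qpow_zero]
  K_add c d := by
    ext i : 2
    simp [add_mul, qpow_add, mul_comm]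
  K_E c := by
    ext i : 2
    rcases i with _ | i
    · simp [qnum_zero]
    · simp only [LinearMap.comp_apply, Module.End.mul_apply, Finsupp.lsum_single,
        LinearMap.smul_apply, Finsupp.lsingle_apply, Nat.add_sub_cancel,
        Finsupp.smul_single, smul_eq_mul, mul_one]
      congr 1
      have h : qpow η (-c * (μ - 2 * ((i + 1 : ℕ) : ℂ))) * qpow η (c * (μ - 2 * (i : ℂ))) =
          qpow η (2 * c) := by
        rw [← qpow_add]; congr 1; push_cast; ring
      rw [← h]; ring
  K_F c := by
    ext i : 2
    simp only [LinearMap.comp_apply, Module.End.mul_apply, Finsupp.lsum_single,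
      LinearMap.smul_apply, Finsupp.lsingle_apply,
      Finsupp.smul_single, smul_eq_mul, mul_one]
    congr 1
    rw [← qpow_add]; congr 1; push_cast; ring
  E_F := by
    ext i : 2
    have h := qnum_commutator η i (μ : ℂ)
    rcases i with _ | i
    · simp only [LinearMap.comp_apply, Module.End.mul_apply, LinearMap.sub_apply,
        Finsupp.lsum_single, LinearMap.smul_apply, Finsupp.lsingle_apply,
        Finsupp.smul_single, smul_eq_mul, mul_one, Nat.add_sub_cancel,
        ← Finsupp.single_sub, one_mul, neg_one_mul]
      rw [← div_eq_inv_mul, ← h, Nat.cast_zero, qnum_zero, zero_mul, sub_zero,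
        Finsupp.single_zero, sub_zero]
      congr 1
      push_cast
      ring_nf
    · simp only [LinearMap.comp_apply, Module.End.mul_apply, LinearMap.sub_apply,
        Finsupp.lsum_single, LinearMap.smul_apply, Finsupp.lsingle_apply,
        Finsupp.smul_single, smul_eq_mul, mul_one, Nat.add_sub_cancel,
        ← Finsupp.single_sub, one_mul, neg_one_mul]
      congr 1
      rw [← div_eq_inv_mul, ← h]
      push_cast
      ring_nf

/-! The irreducible module `U` of highest weight `d`. -/

/-- The module of highest weight `d` and dimension `d + 1`, on the basis `w 0, …, w d`:
`F (w i) = w (i + 1)` and `F (w d) = 0`, `E (w i) = [i] [d - i + 1] w (i - 1)`,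
`q ^ (c h) (w i) = q ^ (c (d - 2 i)) w i`. Vectors are given by their coordinates. -/
def irrep (η : ℂ) (d : ℕ) : UqModule η (Fin (d + 1) → ℂ) where
  E := LinearMap.pi fun i => if h : i.val + 1 < d + 1 then
    (qnum η (i.val + 1) * qnum η (d - i.val)) • LinearMap.proj ⟨i.val + 1, h⟩ else 0
  F := LinearMap.pi fun i => if 0 < i.val then
    LinearMap.proj ⟨i.val - 1, lt_of_le_of_lt (Nat.sub_le _ _) i.isLt⟩ else 0
  K c := LinearMap.pi fun i => qpow η (c * (d - 2 * (i.val : ℂ))) • LinearMap.proj i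
  K_zero := by
    refine LinearMap.ext fun f => funext fun i => ?_
    simp [qpow_zero]
  K_add c e := by
    refine LinearMap.ext fun f => funext fun i => ?_
    simp [add_mul, qpow_add, mul_assoc]
  K_E c := by
    refine LinearMap.ext fun f => funext fun i => ?_
    by_cases h : i.val + 1 < d + 1
    · simp only [Module.End.mul_apply, LinearMap.pi_apply, LinearMap.smul_apply,
        LinearMap.proj_apply, Pi.smul_apply, dif_pos h, smul_eq_mul]
      have h : qpow η (c * (d - 2 * (i.val : ℂ))) *
          qpow η (-c * (d - 2 * ((i.val + 1 : ℕ) : ℂ))) = qpow η (2 * c) := by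
        rw [← qpow_add]; congr 1; push_cast; ring
      rw [← h]; ring
    · simp only [Module.End.mul_apply, LinearMap.pi_apply, LinearMap.smul_apply,
        LinearMap.proj_apply, Pi.smul_apply, dif_neg h, LinearMap.zero_apply, smul_zero]
  K_F c := by
    refine LinearMap.ext fun f => funext fun i => ?_
    by_cases h : 0 < i.val
    · simp only [Module.End.mul_apply, LinearMap.pi_apply, LinearMap.smul_apply,
        LinearMap.proj_apply, Pi.smul_apply, if_pos h, smul_eq_mul]
      have h : qpow η (c * (d - 2 * (i.val : ℂ))) *
          qpow η (-c * (d - 2 * ((i.val - 1 : ℕ) : ℂ))) = qpow η (-(2 * c)) := by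
        rw [← qpow_add]; congr 1; rw [Nat.cast_sub h]; push_cast; ring
      rw [← h]; ring
    · simp only [Module.End.mul_apply, LinearMap.pi_apply, LinearMap.smul_apply,
        LinearMap.proj_apply, Pi.smul_apply, if_neg h, LinearMap.zero_apply, smul_zero]
  E_F := by
    refine LinearMap.ext fun f => funext fun i => ?_
    obtain ⟨i, hi⟩ := i
    have hc := qnum_commutator η i (d : ℂ)
    have e1 : ∀ x, (qpow η 1 - qpow η (-1))⁻¹ * (qpow η (d - 2 * (i : ℂ)) * x -
        qpow η (-(d - 2 * (i : ℂ))) * x) =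
        (qnum η (i + 1) * qnum η (d - i) - qnum η i * qnum η (d - i + 1)) * x := by
      intro x; rw [hc]; ring
    simp only [Module.End.mul_apply, LinearMap.sub_apply, LinearMap.pi_apply,
      LinearMap.smul_apply, LinearMap.proj_apply, Pi.sub_apply, Pi.smul_apply, smul_eq_mul,
      one_mul, neg_one_mul, e1]
    rcases i with _ | i
    · rw [if_neg (lt_irrefl 0)]
      by_cases h : 0 + 1 < d + 1
      · simp only [dif_pos h, LinearMap.smul_apply, LinearMap.proj_apply, LinearMap.pi_apply,
          if_pos (Nat.succ_pos 0), smul_eq_mul, LinearMap.zero_apply, sub_zero, Nat.cast_zero,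
          qnum_zero, zero_mul, Nat.add_sub_cancel]
      · have hd : d = 0 := by omega
        subst hd
        simp only [dif_neg h, LinearMap.zero_apply, Nat.cast_zero, sub_zero, qnum_zero,
          zero_mul, mul_zero]
    · simp only [if_pos (Nat.succ_pos i), LinearMap.proj_apply, LinearMap.pi_apply,
        Nat.add_sub_cancel, dif_pos hi, LinearMap.smul_apply, smul_eq_mul]
      have h2 : (d : ℂ) - i = d - ((i + 1 : ℕ) : ℂ) + 1 := by push_cast; ring
      by_cases h : i + 1 + 1 < d + 1
      · simp only [dif_pos h, LinearMap.smul_apply, LinearMap.proj_apply, LinearMap.pi_apply,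
          if_pos (Nat.succ_pos (i + 1)), smul_eq_mul, Nat.add_sub_cancel, h2]
        push_cast
        ring
      · have hd : d = i + 1 := by omega
        subst hd
        simp only [dif_neg h, LinearMap.zero_apply, h2, sub_self, qnum_zero, mul_zero]
        push_cast
        ring

/-! Intertwining operators and their traces. Here `U = irrep η (2 k)`. -/

/-- The linear map `M_μ ⊗ U → U` that extracts the coefficient of `F ^ i v_μ`. -/
def coordinate (U : Type*) [AddCommGroup U] [Module ℂ U] (i : ℕ) :
    (ℕ →₀ ℂ) ⊗[ℂ] U →ₗ[ℂ] U :=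
  (TensorProduct.lid ℂ U).toLinearMap ∘ₗ LinearMap.rTensor U (Finsupp.lapply i)

/-- `Φ : M_μ → M_μ ⊗ U` is the intertwining operator `Φ_μ ^ u`: it is `U_q(sl₂)`-linear, and
`Φ v_μ = v_μ ⊗ u + ∑_{j ≥ 1} F ^ j v_μ ⊗ u_j` for some `u_j`. -/
def IsIntertwiner (η μ : ℂ) (k : ℕ) (u : Fin (2 * k + 1) → ℂ)
    (Φ : (ℕ →₀ ℂ) →ₗ[ℂ] (ℕ →₀ ℂ) ⊗[ℂ] (Fin (2 * k + 1) → ℂ)) : Prop :=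
  IsUqHom (verma η μ) ((verma η μ).tensor (irrep η (2 * k))) Φ ∧
    coordinate _ 0 (Φ (Finsupp.single 0 1)) = u

/-- `ψ ∈ ℂ` is the value at `(ν, μ)` of the trace function given by a convergent series: for `u`
in the zero weight space `U[0]`, the operator `Φ_μ ^ u` exists and `Tr|_{M_μ} (Φ_μ ^ u q ^ (ν h))`,
the sum over the basis of `M_μ` of the (`U`-valued) diagonal entries, converges to `ψ u`. -/
def HasTrace (η ν μ : ℂ) (k : ℕ) (ψ : ℂ) : Prop :=
  ∀ u : Fin (2 * k + 1) → ℂ, (irrep η (2 * k)).K 1 u = u →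
    ∃ Φ, IsIntertwiner η μ k u Φ ∧
      HasSum (fun i : ℕ => coordinate _ i (Φ ((verma η μ).K ν (Finsupp.single i 1)))) (ψ • u)

/-- The values of `ν` at which no pole of the renormalized trace function can occur:
`[ν - l] ≠ 0` for all integers `l` with `|l| ≤ k`. -/
def regularDomain (η : ℂ) (k : ℕ) : Set ℂ :=
  {ν | ∀ l : ℤ, |l| ≤ (k : ℤ) → qpow η (2 * (ν - l)) ≠ 1}

/-- The conditions that determine the renormalized trace function `Ψ (ν, μ)` (for `ν` in
`regularDomain η k` and all `μ`): for generic `μ` and for `ν` in the region where the trace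
converges, it is
`∏_{j=1}^k (q ^ (μ + 1 - j) - q ^ (-μ - 1 + j)) / (q ^ (ν + j) - q ^ (-ν - j))`
times the trace function; in `ν` it is continued analytically to the regular domain; in `μ` it is
entire. The number `q = exp η` is supposed to be of absolute value `1`. -/
structure IsRenormalizedTrace (η : ℂ) (k : ℕ) (Ψ : ℂ → ℂ → ℂ) : Prop where
  eq_trace : ∀ μ ν : ℂ, (∀ l : ℕ, qpow η (2 * (μ - l)) ≠ 1) → ‖qpow η (-(2 * ν))‖ < 1 →
    ∃ ψ, HasTrace η ν μ k ψ ∧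
      Ψ ν μ = (∏ j ∈ Finset.Icc 1 k, (qpow η (μ + 1 - j) - qpow η (-μ - 1 + j)) /
        (qpow η (ν + j) - qpow η (-ν - j))) * ψ
  holomorphic_left : ∀ μ, DifferentiableOn ℂ (fun ν => Ψ ν μ) (regularDomain η k)
  holomorphic_right : ∀ ν ∈ regularDomain η k, Differentiable ℂ (fun μ => Ψ ν μ)

/-- The renormalized trace function `Ψ^{(k)} (q, ν, μ)` for `q = exp η`. -/
def renormalizedTrace (η : ℂ) (k : ℕ) : ℂ → ℂ → ℂ :=
  Classical.epsilon fun Ψ => IsRenormalizedTrace η k Ψ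

/-! Macdonald polynomials of type `A₁`. The Laurent variable `T` stands for `q ^ x`. -/

/-- `∏_{j=0}^{k-1} (1 - q ^ (2 (j + x))) (1 - q ^ (2 (j - x)))`. -/
def macdonaldWeight {R : Type*} [Field R] (q : R) (k : ℕ) : R[T;T⁻¹] :=
  ∏ j ∈ Finset.range k,
    ((1 - LaurentPolynomial.C (q ^ (2 * j)) * LaurentPolynomial.T 2) *
      (1 - LaurentPolynomial.C (q ^ (2 * j)) * LaurentPolynomial.T (-2)))

/-- `⟨f, g⟩`, half of the constant term of `f g` times the weight. -/
def macdonaldForm {R : Type*} [Field R] (q : R) (k : ℕ) (f g : R[T;T⁻¹]) : R :=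
  (1 / 2) * (f * g * macdonaldWeight q k).coeff 0

/-- The conditions that define the Macdonald polynomials `P_n^{(k)}`, `n ≥ 0`. -/
structure IsMacdonaldFamily {R : Type*} [Field R] (q : R) (k : ℕ) (P : ℕ → R[T;T⁻¹]) :
    Prop where
  even : ∀ n, LaurentPolynomial.invert (P n) = P n
  zero : P 0 = 1
  leading : ∀ n : ℕ, 0 < n → ∀ i : ℤ, (n : ℤ) ≤ |i| →
    (P n).coeff i =
      (LaurentPolynomial.T (n : ℤ) + LaurentPolynomial.T (-(n : ℤ)) : R[T;T⁻¹]).coeff i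
  orthogonal : ∀ m n, m ≠ n → macdonaldForm q k (P m) (P n) = 0

/-- The Macdonald polynomials for an indeterminate `q`, with coefficients in `ℂ(q)`. -/
def macdonald (k : ℕ) : ℕ → (RatFunc ℂ)[T;T⁻¹] :=
  Classical.epsilon fun P => IsMacdonaldFamily (RatFunc.X : RatFunc ℂ) k P

/-- The coefficients of `P_n^{(k)}`, as rational functions of `q`, have no pole at `q = exp η`. -/
def MacdonaldRegular (η : ℂ) (k n : ℕ) : Prop :=
  ∀ i : ℤ, ((macdonald k n).coeff i).denom.eval (qpow η 1) ≠ 0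

/-- The value `P_n^{(k)} (x)` at `q = exp η`: the coefficients are evaluated at this `q`, and
`T` is replaced by `q ^ x`. -/
def macdonaldValue (η : ℂ) (k n : ℕ) (x : ℂ) : ℂ :=
  ∑ i ∈ (macdonald k n).coeff.support,
    ((macdonald k n).coeff i).eval (RingHom.id ℂ) (qpow η 1) * qpow η (i * x)

end QuantumTrace

end

open scoped TensorProduct LaurentPolynomial

noncomputable section

namespace QuantumTrace

/-! Gaussian binomial coefficients. -/

/-! Let `q` be the base of the trace function, `p = q⁻²`, `M = q^(-2μ)`, `z = q^(-2ν)`. The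
intertwiner is determined by the image of the highest weight vector, a singular vector of `M_μ ⊗ U`
that is found by solving `E s = 0` recursively. The two summands of `Δ F` commute up to a power of
`q`, so the noncommutative binomial theorem expresses the diagonal entries by Gaussian binomials,
and the trace is a finite sum of their generating functions. After renormalization,
q-Chu–Vandermonde evaluates the coefficient of `z^m`: up to a factor independent of `m` it is the
product over `l < k` of `(1 - p^(l+1+m)) (1 - M p^(-l-m))` (`trace_coeff`, `explicitTrace_eq`).

This product is a Laurent polynomial in `p^m`, so the sum over `m` is a combination of `2k+1` simple
fractions, `explicitTrace`. It is analytic wherever required, and by the identity theorem it is the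
only such continuation (`IsRenormalizedTrace.unique`).

The numerators of these fractions are the coefficients of `tracePoly`. Passing from `μ = n-1` to `μ
= -n-1` only rescales its variable by `q^(2n)` (`tracePoly_neg`). In the difference of the two
values each infinite geometric series is therefore cut off after `n` terms. Of the resulting `n`
coefficients the last `k` vanish; with `N = n-k-1`, the others are the products of `(1 - p^(j+l+1))
(1 - p^(N-j+l+1))`, `0 ≤ j ≤ N`.

Up to a common factor these are also the coefficients of the Rogers polynomial with parameter
`q^(2(k+1))`, which is `P_N^{(k+1)}`. Its orthogonality comes from a linear recurrence: as functions
of `j` the coefficients are combinations of the exponentials `Q^(js)`, `|s| ≤ k`, with `Q = q²`, and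
half of the weight is a difference operator that annihilates all of these
(`sum_weightPoly_mul_rogersInterp`). -/

/-- The Gaussian binomial coefficient, defined by the `q`-Pascal rule. -/
def qBinom {R : Type*} [CommRing R] (q : R) : ℕ → ℕ → R
  | _, 0 => 1
  | 0, _ + 1 => 0
  | n + 1, r + 1 => qBinom q n r + q ^ (r + 1) * qBinom q n (r + 1)

section CommRing

variable {R : Type*} [CommRing R] (q : R)

@[simp] theorem qBinom_zero_right (n : ℕ) : qBinom q n 0 = 1 := by cases n <;> rfl

@[simp] theorem qBinom_zero_succ (r : ℕ) : qBinom q 0 (r + 1) = 0 := rfl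

theorem qBinom_succ_succ (n r : ℕ) :
    qBinom q (n + 1) (r + 1) = qBinom q n r + q ^ (r + 1) * qBinom q n (r + 1) := rfl

theorem qBinom_eq_zero {n r : ℕ} (h : n < r) : qBinom q n r = 0 := by
  induction n generalizing r with
  | zero => obtain ⟨r, rfl⟩ := Nat.exists_eq_succ_of_ne_zero h.ne'; rfl
  | succ n ih =>
    obtain ⟨r, rfl⟩ := Nat.exists_eq_succ_of_ne_zero (Nat.ne_zero_of_lt h)
    rw [Nat.succ_eq_add_one, qBinom_succ_succ, ih (by omega), ih (by omega)]
    ring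

@[simp] theorem qBinom_self (n : ℕ) : qBinom q n n = 1 := by
  induction n with
  | zero => rfl
  | succ n ih => rw [qBinom_succ_succ, ih, qBinom_eq_zero q (Nat.lt_succ_self n)]; ring

/-- The other form of the `q`-Pascal rule. -/
theorem qBinom_succ_succ' (n r : ℕ) :
    qBinom q (n + 1) (r + 1) = q ^ (n - r) * qBinom q n r + qBinom q n (r + 1) := by
  induction n generalizing r with
  | zero => cases r <;> simp [qBinom_succ_succ]
  | succ n ih =>
    rw [qBinom_succ_succ]
    cases r with
    | zero =>
      have h := ih 0
      have h2 := qBinom_succ_succ q n 0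
      simp only [qBinom_zero_right, Nat.sub_zero, zero_add, pow_one, mul_one] at h h2 ⊢
      have h3 : q * qBinom q (n + 1) 1 = q ^ (n + 1) + q * qBinom q n 1 := by rw [h]; ring
      rw [h3, h2]; ring
    | succ r =>
      rcases lt_or_ge n (r + 1) with hr | hr
      · rcases Nat.lt_or_ge n r with h | h
        · simp [qBinom_eq_zero q (show n + 1 < r + 1 by omega),
            qBinom_eq_zero q (show n + 1 < r + 1 + 1 by omega)]
        · obtain rfl : n = r := by omega
          simp [qBinom_eq_zero q (show n + 1 < n + 1 + 1 by omega)]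
      · have e1 := ih r
        have e2 := ih (r + 1)
        have e3 := qBinom_succ_succ q n r
        have e4 := qBinom_succ_succ q n (r + 1)
        obtain ⟨d, rfl⟩ := Nat.exists_eq_add_of_le hr
        rw [show r + 1 + d - r = d + 1 by omega] at e1
        rw [show r + 1 + d - (r + 1) = d by omega] at e2
        rw [show r + 1 + d + 1 - (r + 1) = d + 1 by omega]
        linear_combination e1 + q ^ (r + 1 + 1) * e2 - q ^ (d + 1) * e3 - e4

/-- The difference of the two Pascal rules. The truncated exponent `n - r` is harmless: for `n < r`
both binomials vanish. -/
theorem qBinom_succ_mul (n r : ℕ) :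
    qBinom q n (r + 1) * (1 - q ^ (r + 1)) = qBinom q n r * (1 - q ^ (n - r)) := by
  have h1 := qBinom_succ_succ q n r
  have h2 := qBinom_succ_succ' q n r
  linear_combination h1 - h2

theorem qBinom_mul_prod (n r : ℕ) :
    qBinom q (n + r) r * ∏ l ∈ Finset.range r, (1 - q ^ (l + 1)) =
      ∏ l ∈ Finset.range r, (1 - q ^ (n + l + 1)) := by
  induction r generalizing n with
  | zero => simp
  | succ r ih =>
    rw [Finset.prod_range_succ, Finset.prod_range_succ']
    have h := qBinom_succ_mul q (n + (r + 1)) r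
    rw [show n + (r + 1) - r = n + 1 by omega] at h
    have h2 := ih (n + 1)
    rw [show n + 1 + r = n + (r + 1) by ring] at h2
    rw [show ∏ l ∈ Finset.range r, (1 - q ^ (n + (l + 1) + 1)) =
      ∏ l ∈ Finset.range r, (1 - q ^ (n + 1 + l + 1)) from
      Finset.prod_congr rfl fun l _ => by ring_nf, ← h2]
    simp only [add_zero]
    linear_combination (∏ l ∈ Finset.range r, (1 - q ^ (l + 1))) * h

/-- The `q`-Chu–Vandermonde identity. -/
theorem q_vandermonde (a b : R) (k : ℕ) :
    ∏ l ∈ Finset.range k, (1 - a * b * q ^ l) =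
      ∑ j ∈ Finset.range (k + 1), qBinom q k j * b ^ j *
        (∏ l ∈ Finset.range j, (1 - a * q ^ l)) * ∏ l ∈ Finset.range (k - j), (1 - b * q ^ l) := by
  induction k with
  | zero => simp
  | succ k ih =>
    set A : ℕ → R := fun j => ∏ l ∈ Finset.range j, (1 - a * q ^ l)
    set B : ℕ → R := fun j => ∏ l ∈ Finset.range j, (1 - b * q ^ l)
    have hA : ∀ j, A (j + 1) = A j * (1 - a * q ^ j) := fun j => Finset.prod_range_succ _ _
    have hB : ∀ j, B (j + 1) = B j * (1 - b * q ^ j) := fun j => Finset.prod_range_succ _ _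
    change _ = ∑ j ∈ Finset.range (k + 1 + 1), qBinom q (k + 1) j * b ^ j * A j * B (k + 1 - j)
    change _ = ∑ j ∈ Finset.range (k + 1), qBinom q k j * b ^ j * A j * B (k - j) at ih
    rw [Finset.prod_range_succ, ih, Finset.sum_range_succ' _ (k + 1), Finset.sum_mul]
    have h1 : ∀ j ∈ Finset.range (k + 1),
        qBinom q (k + 1) (j + 1) * b ^ (j + 1) * A (j + 1) * B (k + 1 - (j + 1)) =
        q ^ (k - j) * qBinom q k j * b ^ (j + 1) * A (j + 1) * B (k - j) +
          qBinom q k (j + 1) * b ^ (j + 1) * A (j + 1) * B (k - j) := by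
      intro j _
      rw [qBinom_succ_succ', Nat.add_sub_add_right]; ring
    -- The splitting `1 - a b q^k = q^(k-j) b (1 - a q^j) + (1 - b q^(k-j))` lengthens either the
    -- first or the second product by one factor.
    have h2 : ∀ j ∈ Finset.range (k + 1),
        qBinom q k j * b ^ j * A j * B (k - j) * (1 - a * b * q ^ k) =
        q ^ (k - j) * qBinom q k j * b ^ (j + 1) * A (j + 1) * B (k - j) +
          qBinom q k j * b ^ j * A j * B (k + 1 - j) := by
      intro j hj
      have hj : j ≤ k := by simpa [Nat.lt_succ_iff] using hj
      obtain ⟨d, rfl⟩ := Nat.exists_eq_add_of_le hj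
      rw [show j + d - j = d by omega, show j + d + 1 - j = d + 1 by omega, hA, hB]
      ring
    rw [Finset.sum_congr rfl h1, Finset.sum_congr rfl h2, Finset.sum_add_distrib,
      Finset.sum_add_distrib, add_assoc]
    congr 1
    rw [Finset.sum_range_succ', Finset.sum_range_succ _ k, qBinom_eq_zero q (Nat.lt_succ_self k)]
    simp only [Nat.sub_zero, qBinom_zero_right, zero_mul, add_zero]
    congr 1
    refine Finset.sum_congr rfl fun j _ => ?_
    rw [show k + 1 - (j + 1) = k - j by omega]

/-- The coefficient form of multiplying a generating function by the geometric series of ratio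
`q^(r+1) z`. -/
theorem qBinom_eq_sum_antidiagonal (r i : ℕ) :
    qBinom q (i + r + 1) (r + 1) =
      ∑ x ∈ Finset.HasAntidiagonal.antidiagonal i, qBinom q (x.1 + r) r * q ^ ((r + 1) * x.2) := by
  induction i with
  | zero => simp
  | succ i ih =>
    rw [Finset.Nat.sum_antidiagonal_succ', qBinom_succ_succ,
      show i + 1 + r = i + r + 1 by ring, ih, Finset.mul_sum, mul_zero, pow_zero, mul_one,
      show i + r + 1 = i + 1 + r by ring]
    congr 1
    · refine Finset.sum_congr rfl fun x _ => ?_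
      dsimp only
      ring

end CommRing

/-- The noncommutative `q`-binomial theorem. -/
theorem add_pow_of_q_commute {A : Type*} [Semiring A] [Algebra ℂ A] (q : ℂ) {x y : A}
    (h : y * x = q • (x * y)) (n : ℕ) :
    (x + y) ^ n = ∑ r ∈ Finset.range (n + 1), qBinom q n r • (x ^ (n - r) * y ^ r) := by
  -- Moving one `x` to the left past `y^r` costs `q^r`, which is the weight in the Pascal rule.
  have hr : ∀ r : ℕ, y ^ r * x = q ^ r • (x * y ^ r) := by
    intro r
    induction r with
    | zero => simp
    | succ r ih =>
      rw [pow_succ, mul_assoc, h, mul_smul_comm, ← mul_assoc, ih, smul_mul_assoc, smul_smul,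
        mul_assoc, ← pow_succ']
  induction n with
  | zero => simp
  | succ n ih =>
    rw [pow_succ, ih, Finset.sum_mul, Finset.sum_range_succ' _ (n + 1)]
    have h1 : ∀ r ∈ Finset.range (n + 1),
        qBinom q n r • (x ^ (n - r) * y ^ r) * (x + y) =
        (q ^ r * qBinom q n r) • (x ^ (n + 1 - r) * y ^ r) +
          qBinom q n r • (x ^ (n - r) * y ^ (r + 1)) := by
      intro r hr'
      have hr' : r ≤ n := by simpa [Nat.lt_succ_iff] using hr'
      rw [mul_add, smul_mul_assoc, smul_mul_assoc, mul_assoc, hr, mul_smul_comm, smul_smul,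
        ← mul_assoc, ← pow_succ, mul_assoc, ← pow_succ, Nat.succ_sub hr', mul_comm (qBinom q n r)]
    rw [Finset.sum_congr rfl h1, Finset.sum_add_distrib, Finset.sum_range_succ']
    simp only [qBinom_succ_succ, add_smul, Finset.sum_add_distrib, Nat.add_sub_add_right,
      qBinom_zero_right, pow_zero, mul_one]
    rw [Finset.sum_range_succ (fun r => (q ^ (r + 1) * qBinom q n (r + 1)) •
      (x ^ (n - r) * y ^ (r + 1))) n, qBinom_eq_zero q (Nat.lt_succ_self n)]
    simp only [mul_zero, zero_smul, add_zero, Nat.sub_zero]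
    abel

/-! ### Generating functions of Gaussian binomials -/

theorem summable_and_hasSum_qBinom {q z : ℂ} (hq : ‖q‖ ≤ 1) (hz : ‖z‖ < 1) (r : ℕ) :
    Summable (fun i : ℕ => ‖qBinom q (i + r) r * z ^ i‖) ∧
      HasSum (fun i : ℕ => qBinom q (i + r) r * z ^ i)
        (∏ l ∈ Finset.range (r + 1), (1 - q ^ l * z))⁻¹ := by
  have geo : ∀ r : ℕ, ‖q ^ r * z‖ < 1 := by
    intro r
    rw [norm_mul, norm_pow]
    exact lt_of_le_of_lt (mul_le_of_le_one_left (norm_nonneg _)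
      (pow_le_one₀ (norm_nonneg _) hq)) hz
  -- Absolute summability is carried through the induction because the Cauchy product with the next
  -- geometric series needs it.
  induction r with
  | zero =>
    have h := geo 0
    simp only [pow_zero, one_mul] at h
    constructor
    · simpa using summable_geometric_of_lt_one (norm_nonneg z) h
    · simpa using hasSum_geometric_of_norm_lt_one h
  | succ r ih =>
    obtain ⟨h1, h2⟩ := ih
    have h3 : Summable fun i : ℕ => ‖(q ^ (r + 1) * z) ^ i‖ := by
      simpa only [norm_pow] using summable_geometric_of_lt_one (norm_nonneg _) (geo (r + 1))
    have key : (fun i : ℕ => ∑ x ∈ Finset.HasAntidiagonal.antidiagonal i,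
        qBinom q (x.1 + r) r * z ^ x.1 * (q ^ (r + 1) * z) ^ x.2) =
        fun i : ℕ => qBinom q (i + (r + 1)) (r + 1) * z ^ i := by
      funext i
      rw [← add_assoc, qBinom_eq_sum_antidiagonal, Finset.sum_mul]
      refine Finset.sum_congr rfl fun x hx => ?_
      rw [Finset.HasAntidiagonal.mem_antidiagonal] at hx
      rw [← hx, pow_add z, mul_pow, ← pow_mul]; ring
    have h4 := summable_norm_sum_mul_antidiagonal_of_summable_norm h1 h3
    have h5 := tsum_mul_tsum_eq_tsum_sum_antidiagonal_of_summable_norm h1 h3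
    rw [h2.tsum_eq, tsum_geometric_of_norm_lt_one (geo (r + 1))] at h5
    rw [tsum_congr fun i => congrFun key i] at h5
    replace h4 := h4.congr fun i => congrArg norm (congrFun key i)
    refine ⟨h4, ?_⟩
    rw [Finset.prod_range_succ, mul_inv, h5]
    exact h4.of_norm.hasSum

theorem hasSum_qBinom {q z : ℂ} (hq : ‖q‖ ≤ 1) (hz : ‖z‖ < 1) (r : ℕ) :
    HasSum (fun i : ℕ => qBinom q i r * z ^ i)
      (z ^ r * (∏ l ∈ Finset.range (r + 1), (1 - q ^ l * z))⁻¹) := by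
  have h : HasSum (fun i : ℕ => qBinom q (i + r) r * z ^ (i + r))
      (z ^ r * (∏ l ∈ Finset.range (r + 1), (1 - q ^ l * z))⁻¹) := by
    refine ((summable_and_hasSum_qBinom hq hz r).2.mul_left (z ^ r)).congr_fun fun i => ?_
    rw [pow_add]; ring
  have h2 := (hasSum_nat_add_iff (f := fun i : ℕ => qBinom q i r * z ^ i) r).1 h
  rwa [Finset.sum_eq_zero, add_zero] at h2
  intro i hi
  rw [qBinom_eq_zero q (Finset.mem_range.1 hi), zero_mul]

/-- The comparison of the coefficients of the trace with those of its continuation. -/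
theorem trace_coeff_term {p M : ℂ} {k : ℕ} {d : ℕ → ℂ} (hp : p ≠ 0) (hd0 : d 0 = 1)
    (h1 : ∀ j, j < 2 * k → 1 - p ^ (j + 1) ≠ 0)
    (h2 : ∀ j : ℕ, j < k → 1 - M * p ^ (-j : ℤ) ≠ 0)
    (hd : ∀ j, j < k → d (j + 1) * (1 - p ^ (j + 1)) * (1 - M * p ^ (-j : ℤ)) =
      -(M * p ^ (-(k + j : ℤ))) * (1 - p ^ (k - j)) * (1 - p ^ (k + j + 1)) * d j)
    (m j : ℕ) (hj : j ≤ k) :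
    (∏ l ∈ Finset.range k, (1 - M * p ^ (-l : ℤ))) * d j *
        (p ^ (-(j * (m - j)) : ℤ) * qBinom p (m + k) (k + j)) =
      qBinom p (m + k) k * (qBinom p k j * (M * p ^ (1 - k : ℤ)) ^ j *
        (∏ l ∈ Finset.range j, (1 - p ^ (-m : ℤ) * p ^ l)) *
          ∏ l ∈ Finset.range (k - j), (1 - M * p ^ (1 - k : ℤ) * p ^ l)) := by
  -- Both sides satisfy the same first-order recursion in `j`, so it suffices to match the ratios of
  -- consecutive terms. The exponent `-j (m - j)` compensates the powers of `p` in these ratios.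
  induction j with
  | zero =>
    have : ∏ l ∈ Finset.range k, (1 - M * p ^ (-l : ℤ)) =
        ∏ l ∈ Finset.range k, (1 - M * p ^ (1 - k : ℤ) * p ^ l) := by
      rw [← Finset.prod_range_reflect]
      refine Finset.prod_congr rfl fun l hl => ?_
      rw [Finset.mem_range] at hl
      rw [mul_assoc, ← zpow_natCast, ← zpow_add₀ hp]
      congr 3
      omega
    rw [this, hd0]
    simp only [Nat.cast_zero, zero_mul, neg_zero, zpow_zero, add_zero, one_mul, mul_one,
      qBinom_zero_right, pow_zero, Finset.range_zero, Finset.prod_empty, Nat.sub_zero]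
    rw [mul_comm]
  | succ j ih =>
    have ih := ih (by omega)
    have e1 := hd j (by omega)
    have n1 := h1 j (by omega)
    have n2 := h2 j (by omega)
    have n3 := h1 (k + j) (by omega)
    have e2 := qBinom_succ_mul p (m + k) (k + j)
    have e3 := qBinom_succ_mul p k j
    -- An integer exponent replaces the truncated one; for `m < j` the binomials on both sides are
    -- zero.
    have e2' : qBinom p (m + k) (k + j + 1) * (1 - p ^ (k + j + 1)) =
        qBinom p (m + k) (k + j) * (1 - p ^ (m - j : ℤ)) := by
      rw [e2]
      rcases lt_or_ge m j with h | h
      · rw [qBinom_eq_zero p (show m + k < k + j by omega)]; ring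
      · rw [← zpow_natCast, show ((m + k - (k + j) : ℕ) : ℤ) = (m - j : ℤ) by omega]
    have e4 : ∏ l ∈ Finset.range (k - j), (1 - M * p ^ (1 - k : ℤ) * p ^ l) =
        (∏ l ∈ Finset.range (k - (j + 1)), (1 - M * p ^ (1 - k : ℤ) * p ^ l)) *
          (1 - M * p ^ (-j : ℤ)) := by
      rw [show k - j = k - (j + 1) + 1 by omega, Finset.prod_range_succ]
      congr 2
      rw [mul_assoc, ← zpow_natCast, ← zpow_add₀ hp]
      congr 2
      omega
    have e5 : p ^ (-((j + 1 : ℕ) * (m - (j + 1 : ℕ))) : ℤ) * (-(M * p ^ (-(k + j : ℤ)))) *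
        (1 - p ^ (m - j : ℤ)) =
        p ^ (-(j * (m - j)) : ℤ) * (M * p ^ (1 - k : ℤ) * (1 - p ^ (-m : ℤ) * p ^ j)) := by
      rw [← zpow_natCast p j, ← zpow_add₀ hp]
      have a1 : p ^ (-((j + 1 : ℕ) * (m - (j + 1 : ℕ))) : ℤ) * p ^ (-(k + j : ℤ)) =
          p ^ (-(j * (m - j)) : ℤ) * p ^ (1 - k : ℤ) * p ^ (-m + j : ℤ) := by
        rw [← zpow_add₀ hp, ← zpow_add₀ hp, ← zpow_add₀ hp]
        congr 1; push_cast; ring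
      have a2 : p ^ (-m + j : ℤ) * p ^ (m - j : ℤ) = 1 := by
        rw [← zpow_add₀ hp, show (-m + j + (m - j) : ℤ) = 0 by ring, zpow_zero]
      linear_combination (-M * (1 - p ^ (m - j : ℤ))) * a1 +
        (M * p ^ (-(j * (m - j)) : ℤ) * p ^ (1 - k : ℤ)) * a2
    rw [e4] at ih
    refine mul_right_cancel₀ (mul_ne_zero (mul_ne_zero n1 n2) n3) ?_
    rw [Finset.prod_range_succ _ j, pow_succ (M * p ^ (1 - k : ℤ)) j, ← add_assoc]
    set A := ∏ l ∈ Finset.range k, (1 - M * p ^ (-l : ℤ))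
    set B := ∏ l ∈ Finset.range (k - (j + 1)), (1 - M * p ^ (1 - k : ℤ) * p ^ l)
    set D := ∏ l ∈ Finset.range j, (1 - p ^ (-m : ℤ) * p ^ l)
    set z1 := p ^ (-((j + 1 : ℕ) * (m - (j + 1 : ℕ))) : ℤ)
    set z0 := p ^ (-(j * (m - j)) : ℤ)
    set N := 1 - p ^ (k + j + 1)
    set b := M * p ^ (1 - k : ℤ)
    set w := 1 - M * p ^ (-j : ℤ)
    set bk := qBinom p (m + k) k
    set c := (1 - p ^ (-m : ℤ) * p ^ j)
    calc A * d (j + 1) * (z1 * qBinom p (m + k) (k + j + 1)) * ((1 - p ^ (j + 1)) * w * N)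
        = A * z1 * (d (j + 1) * (1 - p ^ (j + 1)) * w) *
            (qBinom p (m + k) (k + j + 1) * N) := by ring
      _ = (z1 * (-(M * p ^ (-(k + j : ℤ)))) * (1 - p ^ (m - j : ℤ))) * A * d j *
            qBinom p (m + k) (k + j) * (1 - p ^ (k - j)) * N := by rw [e1, e2']; ring
      _ = (A * d j * (z0 * qBinom p (m + k) (k + j))) * b * c * (1 - p ^ (k - j)) * N := by
            rw [e5]; ring
      _ = bk * (qBinom p k j * (1 - p ^ (k - j))) * b ^ j * b * D * c * B * w * N := by
            rw [ih]; ring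
      _ = _ := by rw [← e3]; ring

/-- By `trace_coeff_term` the summands are those of q-Vandermonde with `a = p^(-m)` and `b = M
p^(1-k)`, times the binomial of `m + k` over `k`. That binomial supplies the first half of the
product. The outcome is a Laurent polynomial in `p^m`, which is what makes a partial fraction form
possible. -/
theorem trace_coeff {p M : ℂ} {k : ℕ} {d : ℕ → ℂ} (hp : p ≠ 0) (hd0 : d 0 = 1)
    (h1 : ∀ j, j < 2 * k → 1 - p ^ (j + 1) ≠ 0)
    (h2 : ∀ j : ℕ, j < k → 1 - M * p ^ (-j : ℤ) ≠ 0)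
    (hd : ∀ j, j < k → d (j + 1) * (1 - p ^ (j + 1)) * (1 - M * p ^ (-j : ℤ)) =
      -(M * p ^ (-(k + j : ℤ))) * (1 - p ^ (k - j)) * (1 - p ^ (k + j + 1)) * d j) (m : ℕ) :
    (∏ l ∈ Finset.range k, (1 - p ^ (l + 1))) * ∑ j ∈ Finset.range (k + 1),
        (∏ l ∈ Finset.range k, (1 - M * p ^ (-l : ℤ))) * d j *
        (p ^ (-(j * (m - j)) : ℤ) * qBinom p (m + k) (k + j)) =
      ∏ l ∈ Finset.range k, ((1 - p ^ (l + 1) * p ^ m) * (1 - M * p ^ (-l : ℤ) * p ^ (-m : ℤ))) := by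
  rw [Finset.sum_congr rfl fun j hj => trace_coeff_term hp hd0 h1 h2 hd m j
    (Nat.lt_succ_iff.1 (Finset.mem_range.1 hj)), ← Finset.mul_sum, ← q_vandermonde, ← mul_assoc,
    mul_comm (∏ l ∈ Finset.range k, (1 - p ^ (l + 1))), qBinom_mul_prod, Finset.prod_mul_distrib]
  congr 1
  · exact Finset.prod_congr rfl fun l _ => by ring
  · rw [← Finset.prod_range_reflect]
    refine Finset.prod_congr rfl fun l hl => ?_
    rw [Finset.mem_range] at hl
    rw [← zpow_natCast]
    congr 1
    have : p ^ (1 - k : ℤ) * p ^ ((k - 1 - l : ℕ) : ℤ) = p ^ (-l : ℤ) := by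
      rw [← zpow_add₀ hp]; congr 1; omega
    linear_combination M * p ^ (-m : ℤ) * this

/-! ### Elementary properties of powers of `q` and `q`-numbers -/

theorem qpow_ne_zero (η x : ℂ) : qpow η x ≠ 0 := Complex.exp_ne_zero _

theorem qpow_neg (η x : ℂ) : qpow η (-x) = (qpow η x)⁻¹ := by
  simp [qpow, Complex.exp_neg]

theorem qpow_nat_mul (η x : ℂ) (n : ℕ) : qpow η (n * x) = qpow η x ^ n := by
  rw [qpow, qpow, ← Complex.exp_nat_mul]; ring_nf

theorem qpow_sub_qpow_neg (η x : ℂ) :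
    qpow η x - qpow η (-x) = qpow η x * (1 - qpow η (-(2 * x))) := by
  rw [mul_sub, ← qpow_add]; ring_nf

theorem qpow_sub_qpow_neg_ne_zero {η x : ℂ} (h : qpow η (2 * x) ≠ 1) :
    qpow η x - qpow η (-x) ≠ 0 := by
  rw [qpow_sub_qpow_neg, qpow_neg]
  refine mul_ne_zero (qpow_ne_zero _ _) (sub_ne_zero.2 fun h' => h ?_)
  rw [← inv_inv (qpow η (2 * x)), ← h', inv_one]

theorem qnum_ne_zero {η x : ℂ} (h1 : qpow η 2 ≠ 1) (h : qpow η (2 * x) ≠ 1) : qnum η x ≠ 0 :=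
  div_ne_zero (qpow_sub_qpow_neg_ne_zero h)
    (qpow_sub_qpow_neg_ne_zero (by rwa [mul_one]))

/-! The action on basis vectors. -/

section Basis

variable (η μ : ℂ)

@[simp] theorem verma_F_single (i : ℕ) :
    (verma η μ).F (Finsupp.single i 1) = Finsupp.single (i + 1) 1 := by simp [verma]

theorem verma_E_single (i : ℕ) : (verma η μ).E (Finsupp.single i 1) =
    (qnum η i * qnum η (μ - i + 1)) • Finsupp.single (i - 1) 1 := by simp [verma]

@[simp] theorem verma_E_single_zero : (verma η μ).E (Finsupp.single 0 1) = 0 := by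
  simp [verma, qnum_zero]

@[simp] theorem verma_K_single (c : ℂ) (i : ℕ) : (verma η μ).K c (Finsupp.single i 1) =
    qpow η (c * (μ - 2 * i)) • Finsupp.single i 1 := by simp [verma]

/-- The vector of index `a` of the basis of `irrep η d`; it is zero for `d < a`. -/
def irrepVec (d a : ℕ) : Fin (d + 1) → ℂ := fun i => if i.val = a then 1 else 0

@[simp] theorem irrep_F_irrepVec (d a : ℕ) :
    (irrep η d).F (irrepVec d a) = irrepVec d (a + 1) := by
  funext i
  by_cases h : 0 < i.val
  · have h2 : i.val - 1 = a ↔ i.val = a + 1 := by omega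
    simp only [irrep, irrepVec, LinearMap.pi_apply, if_pos h, LinearMap.proj_apply, h2]
  · have h2 : i.val ≠ a + 1 := by omega
    simp only [irrep, irrepVec, LinearMap.pi_apply, if_neg h, LinearMap.zero_apply, if_neg h2]

@[simp] theorem irrep_K_irrepVec (c : ℂ) (d a : ℕ) :
    (irrep η d).K c (irrepVec d a) = qpow η (c * (d - 2 * a)) • irrepVec d a := by
  funext i
  simp only [irrep, LinearMap.pi_apply, irrepVec, LinearMap.smul_apply, LinearMap.proj_apply,
    Pi.smul_apply]
  split_ifs with h
  · rw [h]
  · simp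

@[simp] theorem irrep_E_irrepVec_zero (d : ℕ) : (irrep η d).E (irrepVec d 0) = 0 := by
  funext i
  simp only [irrep, LinearMap.pi_apply]
  split_ifs with h
  · simp [irrepVec]
  · simp

theorem irrep_E_irrepVec_succ {d a : ℕ} (ha : a < d) : (irrep η d).E (irrepVec d (a + 1)) =
    (qnum η (a + 1) * qnum η (d - a)) • irrepVec d a := by
  funext i
  simp only [irrep, LinearMap.pi_apply]
  split_ifs with h
  · simp only [LinearMap.smul_apply, LinearMap.proj_apply, irrepVec, Pi.smul_apply,
      Nat.add_right_cancel_iff]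
    split_ifs with h2
    · rw [h2]
    · simp
  · simp only [irrepVec, Pi.smul_apply, LinearMap.zero_apply]
    rw [if_neg (by omega), smul_zero]

end Basis

/-- The linear map from a Verma module that takes `F ^ i v` to `F ^ i s`. -/
def vermaLift {η : ℂ} {W : Type*} [AddCommGroup W] [Module ℂ W] (B : UqModule η W) (s : W) :
    (ℕ →₀ ℂ) →ₗ[ℂ] W :=
  Finsupp.linearCombination ℂ fun i : ℕ => (B.F ^ i) s

@[simp] theorem vermaLift_single {η : ℂ} {W : Type*} [AddCommGroup W] [Module ℂ W]
    (B : UqModule η W) (s : W) (i : ℕ) : vermaLift B s (Finsupp.single i 1) = (B.F ^ i) s := by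
  simp [vermaLift]

/-- The universal property of Verma modules. -/
theorem isUqHom_vermaLift {η μ : ℂ} {W : Type*} [AddCommGroup W] [Module ℂ W]
    (B : UqModule η W) {s : W} (hE : B.E s = 0) (hK : ∀ c, B.K c s = qpow η (c * μ) • s) :
    IsUqHom (verma η μ) B (vermaLift B s) := by
  have hF : ∀ x, vermaLift B s ((verma η μ).F x) = B.F (vermaLift B s x) := by
    refine fun x => LinearMap.congr_fun (f := vermaLift B s ∘ₗ (verma η μ).F)
      (g := B.F ∘ₗ vermaLift B s) ?_ x
    ext i
    simp [pow_succ']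
  have hK' : ∀ c i, vermaLift B s ((verma η μ).K c (Finsupp.single i 1)) =
      B.K c (vermaLift B s (Finsupp.single i 1)) := by
    intro c i
    induction i with
    | zero =>
      rw [verma_K_single, map_smul, vermaLift_single]
      simp [hK]
    | succ i ih =>
      rw [← verma_F_single η μ, ← Module.End.mul_apply, UqModule.K_mul_F, hF,
        ← Module.End.mul_apply (B.K c), UqModule.K_mul_F]
      simp only [LinearMap.smul_apply, Module.End.mul_apply, map_smul, hF, ih]
  have hE' : ∀ i, vermaLift B s ((verma η μ).E (Finsupp.single i 1)) =
      B.E (vermaLift B s (Finsupp.single i 1)) := by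
    intro i
    induction i with
    | zero => simp [hE]
    | succ i ih =>
      -- `E` is moved past `F` by the commutator relation in both modules, so compatibility with `F`
      -- and `q^(ch)` and the relation `E s = 0` suffice.
      have h1 := LinearMap.congr_fun (verma η μ).E_F (Finsupp.single i 1)
      have h2 := LinearMap.congr_fun B.E_F (vermaLift B s (Finsupp.single i 1))
      simp only [LinearMap.sub_apply, Module.End.mul_apply, LinearMap.smul_apply,
        sub_eq_iff_eq_add] at h1 h2
      rw [← verma_F_single η μ, h1, hF, h2, map_add, map_smul, map_sub, hK', hK', hF, ih]
  refine ⟨?_, ?_, fun c => ?_⟩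
  · ext i; simpa using hE' i
  · ext i; simpa using hF (Finsupp.single i 1)
  · ext i; simpa using hK' c i

/-! Coordinates in `M_μ ⊗ U`. -/

section Coordinate

variable {η μ : ℂ}

theorem coordinate_tmul {U : Type*} [AddCommGroup U] [Module ℂ U] (i : ℕ) (x : ℕ →₀ ℂ) (w : U) :
    coordinate U i (x ⊗ₜ w) = x i • w := by
  simp [coordinate]

theorem eq_zero_of_coordinate_eq_zero {U : Type*} [AddCommGroup U] [Module ℂ U]
    {t : (ℕ →₀ ℂ) ⊗[ℂ] U} (h : ∀ i, coordinate U i t = 0) : t = 0 := by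
  refine (TensorProduct.finsuppScalarLeft ℂ U ℕ).injective ?_
  rw [map_zero]
  ext i : 1
  rw [TensorProduct.finsuppScalarLeft_apply]
  exact h i

variable {U : Type*} [AddCommGroup U] [Module ℂ U] (B : UqModule η U)

theorem coordinate_tensor_K (c : ℂ) (i : ℕ) (t : (ℕ →₀ ℂ) ⊗[ℂ] U) :
    coordinate U i (((verma η μ).tensor B).K c t) =
      qpow η (c * (μ - 2 * i)) • B.K c (coordinate U i t) := by
  refine LinearMap.congr_fun (f := coordinate U i ∘ₗ ((verma η μ).tensor B).K c)
      (g := qpow η (c * (μ - 2 * i)) • B.K c ∘ₗ coordinate U i) ?_ t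
  ext j w
  by_cases h : j = i
  · subst h
    simp [UqModule.tensor, coordinate_tmul]
  · simp [UqModule.tensor, coordinate_tmul, h]

/-- For a singular vector this is a recursion that determines coordinate `i + 1` from coordinate `i`
as long as `[i+1] [μ-i]` does not vanish. -/
theorem coordinate_tensor_E (i : ℕ) (t : (ℕ →₀ ℂ) ⊗[ℂ] U) :
    coordinate U i (((verma η μ).tensor B).E t) =
      (qnum η (i + 1) * qnum η (μ - i)) • B.K 1 (coordinate U (i + 1) t) +
        B.E (coordinate U i t) := by
  refine LinearMap.congr_fun (f := coordinate U i ∘ₗ ((verma η μ).tensor B).E)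
      (g := (qnum η (i + 1) * qnum η (μ - i)) • B.K 1 ∘ₗ coordinate U (i + 1) +
        B.E ∘ₗ coordinate U i) ?_ t
  ext j w
  rcases j with _ | j
  · by_cases h : 0 = i
    · subst h
      simp [UqModule.tensor, coordinate_tmul]
    · simp [UqModule.tensor, coordinate_tmul, h]
  · by_cases h : j = i
    · subst h
      simp [UqModule.tensor, coordinate_tmul, verma_E_single]
      ring_nf
    · by_cases h2 : j + 1 = i
      · subst h2
        simp [UqModule.tensor, coordinate_tmul, verma_E_single]
      · simp [UqModule.tensor, coordinate_tmul, verma_E_single, h, h2]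

end Coordinate

/-! Intertwining operators `M_μ → M_μ ⊗ U`. -/

section Intertwiner

variable {η μ : ℂ} {k : ℕ}

theorem qpow_two_ne_one (hk : ∀ j : ℕ, 1 ≤ j → j ≤ 2 * k → qpow η (2 * j) ≠ 1) (h : 0 < k) :
    qpow η 2 ≠ 1 := by
  have := hk 1 le_rfl (by omega)
  simpa using this

/-- At a root of unity `[i+1]` can vanish for large `i`, so the recursion from `E` alone is not
enough. The weight condition for all complex `c` leaves only the indices with `a + i = k`; hence
coordinates with `i > k` vanish, and below that the recursion has nonzero factors. -/
theorem eq_zero_of_isSingular (hη : η ≠ 0)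
    (hk : ∀ j : ℕ, 1 ≤ j → j ≤ 2 * k → qpow η (2 * j) ≠ 1)
    (hμ : ∀ l : ℕ, qpow η (2 * (μ - l)) ≠ 1) {t : (ℕ →₀ ℂ) ⊗[ℂ] (Fin (2 * k + 1) → ℂ)}
    (hE : ((verma η μ).tensor (irrep η (2 * k))).E t = 0)
    (hK : ∀ c, ((verma η μ).tensor (irrep η (2 * k))).K c t = qpow η (c * μ) • t)
    (h0 : coordinate _ 0 t = 0) : t = 0 := by
  have hw : ∀ (i : ℕ) (a : Fin (2 * k + 1)), a.val + i ≠ k → coordinate _ i t a = 0 := by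
    intro i a ha
    by_contra hne
    have hx : (2 * k - 2 * i - 2 * a.val : ℂ) ≠ 0 := by
      intro h
      apply ha
      have : (k : ℂ) = ((a.val + i : ℕ) : ℂ) := by push_cast; linear_combination h / 2
      exact_mod_cast this.symm
    -- This `c` is chosen so that `q^c` raised to the weight difference is `e`, which is not `1`.
    set c : ℂ := (η * (2 * k - 2 * i - 2 * a.val))⁻¹ with hc
    have h1 := congrFun (congrArg (coordinate _ i) (hK c)) a
    rw [coordinate_tensor_K, map_smul] at h1
    simp only [Pi.smul_apply, irrep, LinearMap.pi_apply, LinearMap.smul_apply,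
      LinearMap.proj_apply, smul_eq_mul, ← mul_assoc, ← qpow_add] at h1
    have h2 := mul_right_cancel₀ hne h1
    have h3 : qpow η (c * (2 * k - 2 * i - 2 * a.val)) = 1 := by
      refine mul_left_cancel₀ (qpow_ne_zero η (c * μ)) ?_
      rw [mul_one, ← qpow_add]
      refine Eq.trans ?_ h2
      congr 1; push_cast; ring
    rw [qpow, show η * (c * (2 * k - 2 * i - 2 * a.val)) = 1 by
      rw [hc, mul_left_comm]; exact inv_mul_cancel₀ (mul_ne_zero hη hx)] at h3
    have h4 := congrArg norm h3
    rw [Complex.norm_exp, norm_one, Complex.one_re, Real.exp_eq_one_iff] at h4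
    exact one_ne_zero h4
  refine eq_zero_of_coordinate_eq_zero fun i => ?_
  induction i with
  | zero => exact h0
  | succ i ih =>
    by_cases hi : k < i + 1
    · funext a
      exact hw _ _ (by omega)
    · have h1 := coordinate_tensor_E (μ := μ) (irrep η (2 * k)) i t
      rw [hE, ih, map_zero, map_zero, add_zero] at h1
      have h2 := qpow_two_ne_one hk (by omega)
      have h3 : qnum η (i + 1) * qnum η (μ - i) ≠ 0 :=
        mul_ne_zero (qnum_ne_zero h2 (by exact_mod_cast hk (i + 1) (by omega) (by omega)))
          (qnum_ne_zero h2 (hμ i))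
      have h4 := (smul_eq_zero.1 h1.symm).resolve_left h3
      have h5 := LinearMap.congr_fun ((irrep η (2 * k)).K_neg_mul 1)
        (coordinate _ (i + 1) t)
      rw [Module.End.mul_apply, h4, map_zero] at h5
      exact h5.symm

/-- The images of the highest weight vector differ by a singular vector of weight `μ` with zero
leading coordinate; the remaining basis vectors follow by applying `F`. -/
theorem IsIntertwiner.unique (hη : η ≠ 0)
    (hk : ∀ j : ℕ, 1 ≤ j → j ≤ 2 * k → qpow η (2 * j) ≠ 1)
    (hμ : ∀ l : ℕ, qpow η (2 * (μ - l)) ≠ 1) {u : Fin (2 * k + 1) → ℂ}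
    {Φ Φ' : (ℕ →₀ ℂ) →ₗ[ℂ] (ℕ →₀ ℂ) ⊗[ℂ] (Fin (2 * k + 1) → ℂ)}
    (h : IsIntertwiner η μ k u Φ) (h' : IsIntertwiner η μ k u Φ') : Φ = Φ' := by
  obtain ⟨⟨hE, hF, hK⟩, h0⟩ := h
  obtain ⟨⟨hE', hF', hK'⟩, h0'⟩ := h'
  have key : Φ (Finsupp.single 0 1) - Φ' (Finsupp.single 0 1) = 0 := by
    refine eq_zero_of_isSingular hη hk hμ ?_ (fun c => ?_) ?_
    · have e1 := LinearMap.congr_fun hE (Finsupp.single 0 1)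
      have e2 := LinearMap.congr_fun hE' (Finsupp.single 0 1)
      simp only [LinearMap.comp_apply, verma_E_single_zero, map_zero] at e1 e2
      rw [map_sub, ← e1, ← e2, sub_self]
    · have e1 := LinearMap.congr_fun (hK c) (Finsupp.single 0 1)
      have e2 := LinearMap.congr_fun (hK' c) (Finsupp.single 0 1)
      simp only [LinearMap.comp_apply, verma_K_single, map_smul, Nat.cast_zero, mul_zero,
        sub_zero] at e1 e2
      rw [map_sub, ← e1, ← e2, smul_sub]
    · rw [map_sub, h0, h0', sub_self]
  ext i : 2
  simp only [LinearMap.comp_apply, Finsupp.lsingle_apply]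
  induction i with
  | zero => exact sub_eq_zero.1 key
  | succ i ih =>
    have e1 := LinearMap.congr_fun hF (Finsupp.single i 1)
    have e2 := LinearMap.congr_fun hF' (Finsupp.single i 1)
    simp only [LinearMap.comp_apply, verma_F_single] at e1 e2
    rw [e1, e2, ih]

variable (η μ k) in
/-- The coefficients of the singular vector of weight `μ` in `M_μ ⊗ U`. -/
def singularCoeff : ℕ → ℂ
  | 0 => 1
  | j + 1 => -singularCoeff j * (qpow η (-(2 * (j + 1))) * (qnum η (k - j) * qnum η (k + j + 1)) /
      (qnum η (j + 1) * qnum η (μ - j)))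

variable (η μ k) in
/-- The singular vector of weight `μ` in `M_μ ⊗ U`. -/
def singularVec : (ℕ →₀ ℂ) ⊗[ℂ] (Fin (2 * k + 1) → ℂ) :=
  ∑ j ∈ Finset.range (k + 1),
    singularCoeff η μ k j • (Finsupp.single j 1 ⊗ₜ[ℂ] irrepVec (2 * k) (k - j))

/-- The term `j + 1` under `E ⊗ q^h` and the term `j` under `1 ⊗ E` are multiples of the same
tensor; the recursion defining `singularCoeff` is exactly their cancellation. -/
theorem tensor_E_singularVec (hk : ∀ j : ℕ, 1 ≤ j → j ≤ 2 * k → qpow η (2 * j) ≠ 1)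
    (hμ : ∀ l : ℕ, qpow η (2 * (μ - l)) ≠ 1) :
    ((verma η μ).tensor (irrep η (2 * k))).E (singularVec η μ k) = 0 := by
  simp only [singularVec, map_sum, map_smul, UqModule.tensor, LinearMap.add_apply,
    TensorProduct.map_tmul, Module.End.one_apply, smul_add, Finset.sum_add_distrib]
  -- The two end terms vanish: `E` kills the highest weight vector of the Verma module (`j = 0`) and
  -- that of `U` (`j = k`).
  rw [Finset.sum_range_succ', Finset.sum_range_succ _ k]
  simp only [verma_E_single_zero, TensorProduct.zero_tmul, smul_zero, add_zero, Nat.sub_self,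
    irrep_E_irrepVec_zero, TensorProduct.tmul_zero, ← Finset.sum_add_distrib]
  refine Finset.sum_eq_zero fun j hj => ?_
  rw [Finset.mem_range] at hj
  have h2 := qpow_two_ne_one hk (by omega)
  have n1 : qnum η (j + 1) ≠ 0 :=
    qnum_ne_zero h2 (by exact_mod_cast hk (j + 1) (by omega) (by omega))
  have n2 : qnum η (μ - j) ≠ 0 := qnum_ne_zero h2 (hμ j)
  rw [verma_E_single, irrep_K_irrepVec, show k - j = (k - (j + 1)) + 1 by omega,
    irrep_E_irrepVec_succ _ (by omega), ← TensorProduct.smul_tmul', TensorProduct.tmul_smul,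
    TensorProduct.tmul_smul, Nat.add_sub_cancel, singularCoeff, Nat.cast_sub (by omega)]
  simp only [smul_smul, ← add_smul]
  refine (congrArg (· • _) ?_).trans (zero_smul ℂ _)
  rw [show (k - (j + 1 : ℕ) + 1 : ℂ) = k - j by push_cast; ring,
    show ((2 * k : ℕ) - (k - (j + 1 : ℕ)) : ℂ) = k + j + 1 by push_cast; ring,
    show (μ - (j + 1 : ℕ) + 1 : ℂ) = μ - j by push_cast; ring,
    show (1 * ((2 * k : ℕ) - 2 * (k - (j + 1 : ℕ))) : ℂ) = 2 * (j + 1) by push_cast; ring,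
    qpow_neg]
  have n3 := qpow_ne_zero η (2 * (j + 1))
  push_cast
  field_simp
  ring

theorem tensor_K_singularVec (c : ℂ) :
    ((verma η μ).tensor (irrep η (2 * k))).K c (singularVec η μ k) =
      qpow η (c * μ) • singularVec η μ k := by
  simp only [singularVec, map_sum, map_smul, UqModule.tensor, TensorProduct.map_tmul,
    Finset.smul_sum]
  refine Finset.sum_congr rfl fun j hj => ?_
  rw [Finset.mem_range] at hj
  rw [verma_K_single, irrep_K_irrepVec, ← TensorProduct.smul_tmul', TensorProduct.tmul_smul,
    smul_smul, smul_smul, smul_smul, mul_comm (qpow η (c * μ)), mul_assoc, ← qpow_add,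
    Nat.cast_sub (by omega)]
  congr 3
  push_cast; ring

theorem coordinate_zero_singularVec :
    coordinate _ 0 (singularVec η μ k) = irrepVec (2 * k) k := by
  rw [singularVec, map_sum, Finset.sum_range_succ', Finset.sum_eq_zero]
  · simp [coordinate_tmul, singularCoeff]
  · intro j _
    simp [coordinate_tmul]

theorem isIntertwiner_vermaLift (hk : ∀ j : ℕ, 1 ≤ j → j ≤ 2 * k → qpow η (2 * j) ≠ 1)
    (hμ : ∀ l : ℕ, qpow η (2 * (μ - l)) ≠ 1) :
    IsIntertwiner η μ k (irrepVec (2 * k) k)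
      (vermaLift ((verma η μ).tensor (irrep η (2 * k))) (singularVec η μ k)) :=
  ⟨isUqHom_vermaLift _ (tensor_E_singularVec hk hμ) tensor_K_singularVec, by
    simpa using coordinate_zero_singularVec⟩

theorem IsIntertwiner.smul {u : Fin (2 * k + 1) → ℂ}
    {Φ : (ℕ →₀ ℂ) →ₗ[ℂ] (ℕ →₀ ℂ) ⊗[ℂ] (Fin (2 * k + 1) → ℂ)}
    (h : IsIntertwiner η μ k u Φ) (a : ℂ) : IsIntertwiner η μ k (a • u) (a • Φ) := by
  obtain ⟨⟨hE, hF, hK⟩, h0⟩ := h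
  refine ⟨⟨?_, ?_, fun c => ?_⟩, ?_⟩
  · rw [LinearMap.smul_comp, hE, LinearMap.comp_smul]
  · rw [LinearMap.smul_comp, hF, LinearMap.comp_smul]
  · rw [LinearMap.smul_comp, hK, LinearMap.comp_smul]
  · rw [LinearMap.smul_apply, map_smul, h0]

/-! ### Diagonal entries of the intertwining operator and its trace -/

theorem verma_F_pow_single (r j : ℕ) :
    ((verma η μ).F ^ r) (Finsupp.single j 1) = Finsupp.single (j + r) 1 := by
  induction r with
  | zero => simp
  | succ r ih => rw [pow_succ', Module.End.mul_apply, ih, verma_F_single]; rfl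

theorem irrep_F_pow_irrepVec (d r a : ℕ) :
    ((irrep η d).F ^ r) (irrepVec d a) = irrepVec d (a + r) := by
  induction r with
  | zero => simp
  | succ r ih => rw [pow_succ', Module.End.mul_apply, ih, irrep_F_irrepVec]; rfl

theorem verma_K_pow_single (c : ℂ) (r j : ℕ) :
    ((verma η μ).K c ^ r) (Finsupp.single j 1) =
      qpow η (r * (c * (μ - 2 * j))) • Finsupp.single j 1 := by
  induction r with
  | zero => simp [qpow_zero]
  | succ r ih =>
    rw [pow_succ', Module.End.mul_apply, ih, map_smul, verma_K_single, smul_smul, ← qpow_add]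
    congr 2; push_cast; ring

/-- In the binomial expansion of `(Δ F)^i` the term with `r` factors on `U` sends `F^j v` to a
multiple of `F^(j+i-r) v`, so only `r = j` meets the diagonal. -/
theorem coordinate_F_pow_tmul (i j a : ℕ) (d : ℕ) :
    coordinate _ i ((((verma η μ).tensor (irrep η d)).F ^ i)
        (Finsupp.single j 1 ⊗ₜ[ℂ] irrepVec d a)) =
      (qBinom (qpow η 2) i j * qpow η (-(j * (μ - 2 * j)))) • irrepVec d (a + j) := by
  have hcomm : TensorProduct.map ((verma η μ).K (-1)) (irrep η d).F *
      TensorProduct.map (verma η μ).F 1 = qpow η 2 •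
      (TensorProduct.map (verma η μ).F 1 *
        TensorProduct.map ((verma η μ).K (-1)) (irrep η d).F) := by
    rw [← TensorProduct.map_mul, ← TensorProduct.map_mul, UqModule.K_mul_F, mul_one, one_mul,
      TensorProduct.map_smul_left]
    norm_num
  have hF : ((verma η μ).tensor (irrep η d)).F = TensorProduct.map (verma η μ).F 1 +
      TensorProduct.map ((verma η μ).K (-1)) (irrep η d).F := rfl
  have hpow := add_pow_of_q_commute (A := Module.End ℂ ((ℕ →₀ ℂ) ⊗[ℂ] (Fin (d + 1) → ℂ))) _ hcomm i
  have hterm : ∀ r ∈ Finset.range (i + 1), coordinate _ i ((qBinom (qpow η 2) i r •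
      (TensorProduct.map (verma η μ).F (1 : Module.End ℂ (Fin (d + 1) → ℂ)) ^ (i - r) *
        TensorProduct.map ((verma η μ).K (-1)) (irrep η d).F ^ r))
          (Finsupp.single j 1 ⊗ₜ[ℂ] irrepVec d a)) =
      if r = j then
        (qBinom (qpow η 2) i j * qpow η (-(j * (μ - 2 * j)))) • irrepVec d (a + j) else 0 := by
    intro r hr
    have hr : r ≤ i := Nat.lt_succ_iff.1 (Finset.mem_range.1 hr)
    rw [LinearMap.smul_apply, Module.End.mul_apply, TensorProduct.map_pow, TensorProduct.map_pow,
      one_pow, TensorProduct.map_tmul, verma_K_pow_single, irrep_F_pow_irrepVec,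
      TensorProduct.map_tmul, map_smul ((verma η μ).F ^ (i - r)), verma_F_pow_single, map_smul,
      coordinate_tmul,
      Module.End.one_apply]
    split_ifs with h
    · subst h
      rw [Finsupp.smul_apply, show r + (i - r) = i by omega, Finsupp.single_eq_same, smul_smul,
        smul_eq_mul, mul_one]
      congr 3; ring
    · rw [Finsupp.smul_apply, Finsupp.single_eq_of_ne (by omega), smul_zero, zero_smul, smul_zero]
  rw [hF]
  refine (congrArg (fun f : Module.End ℂ ((ℕ →₀ ℂ) ⊗[ℂ] (Fin (d + 1) → ℂ)) =>
    coordinate _ i (f (Finsupp.single j 1 ⊗ₜ[ℂ] irrepVec d a))) hpow).trans ?_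
  rw [LinearMap.sum_apply, map_sum,
    Finset.sum_congr rfl hterm, Finset.sum_ite_eq']
  split_ifs with h
  · rfl
  · rw [qBinom_eq_zero _ (by simpa [Nat.lt_succ_iff] using h), zero_mul, zero_smul]

variable (η μ k) in
/-- The coefficient `c_j q ^ (-j (μ - 2 j))`, where `c_j` are the coefficients of the singular
vector. -/
def traceCoeff (j : ℕ) : ℂ := singularCoeff η μ k j * qpow η (-(j * (μ - 2 * j)))

theorem coordinate_vermaLift (i : ℕ) :
    coordinate _ i (vermaLift ((verma η μ).tensor (irrep η (2 * k))) (singularVec η μ k)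
      (Finsupp.single i 1)) =
    (∑ j ∈ Finset.range (k + 1), traceCoeff η μ k j * qBinom (qpow η 2) i j) •
      irrepVec (2 * k) k := by
  rw [vermaLift_single, singularVec, map_sum, map_sum, Finset.sum_smul]
  refine Finset.sum_congr rfl fun j hj => ?_
  rw [map_smul, map_smul, coordinate_F_pow_tmul, smul_smul,
    Nat.sub_add_cancel (Nat.lt_succ_iff.1 (Finset.mem_range.1 hj)), traceCoeff]
  congr 1; ring

/-- The zero weight space is spanned by the middle basis vector. -/
theorem eq_smul_irrepVec (hk : ∀ j : ℕ, 1 ≤ j → j ≤ 2 * k → qpow η (2 * j) ≠ 1)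
    {u : Fin (2 * k + 1) → ℂ} (hu : (irrep η (2 * k)).K 1 u = u) :
    u = u ⟨k, by omega⟩ • irrepVec (2 * k) k := by
  funext a
  by_cases h : a.val = k
  · simp only [Pi.smul_apply, irrepVec, if_pos h, smul_eq_mul, mul_one]
    congr 1; exact Fin.ext h
  · simp only [Pi.smul_apply, irrepVec, if_neg h, smul_zero]
    have h1 := congrFun hu a
    simp only [irrep, LinearMap.pi_apply, LinearMap.smul_apply, LinearMap.proj_apply, smul_eq_mul,
      one_mul] at h1
    by_contra hne
    have h2 := (mul_eq_right₀ hne).1 h1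
    rcases lt_or_gt_of_ne h with h | h
    · refine hk (k - a.val) (by omega) (by omega) ?_
      rw [← h2, Nat.cast_sub h.le]; congr 1; push_cast; ring
    · refine hk (a.val - k) (by omega) (by omega) ?_
      rw [← inv_inj, inv_one, ← h2, Nat.cast_sub h.le, ← qpow_neg]; congr 1; push_cast; ring

theorem irrep_K_irrepVec_middle (c : ℂ) :
    (irrep η (2 * k)).K c (irrepVec (2 * k) k) = irrepVec (2 * k) k := by
  rw [irrep_K_irrepVec, show c * ((2 * k : ℕ) - 2 * k : ℂ) = 0 by push_cast; ring, qpow_zero,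
    one_smul]

variable (η μ k) in
/-- The trace function. -/
def traceValue (ν : ℂ) : ℂ :=
  qpow η (ν * μ) * ∑ j ∈ Finset.range (k + 1), traceCoeff η μ k j *
    (qpow η (-(2 * ν)) ^ j * (∏ l ∈ Finset.range (j + 1), (1 - qpow η 2 ^ l * qpow η (-(2 * ν))))⁻¹)

theorem hasTrace_traceValue {ν : ℂ} (hk : ∀ j : ℕ, 1 ≤ j → j ≤ 2 * k → qpow η (2 * j) ≠ 1)
    (hμ : ∀ l : ℕ, qpow η (2 * (μ - l)) ≠ 1) (hq : ‖qpow η 2‖ ≤ 1) (hν : ‖qpow η (-(2 * ν))‖ < 1) :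
    HasTrace η ν μ k (traceValue η μ k ν) := by
  intro u hu
  refine ⟨_, ((eq_smul_irrepVec hk hu).symm ▸
    (isIntertwiner_vermaLift hk hμ).smul (u ⟨k, by omega⟩)), ?_⟩
  have h1 : HasSum (fun i : ℕ => qpow η (ν * (μ - 2 * i)) *
      ∑ j ∈ Finset.range (k + 1), traceCoeff η μ k j * qBinom (qpow η 2) i j)
      (traceValue η μ k ν) := by
    refine ((hasSum_sum fun j (_ : j ∈ Finset.range (k + 1)) =>
      (hasSum_qBinom hq hν j).mul_left (traceCoeff η μ k j)).mul_left
        (qpow η (ν * μ))).congr_fun fun i => ?_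
    rw [show ν * (μ - 2 * i) = ν * μ + i * -(2 * ν) by ring, qpow_add, qpow_nat_mul, mul_assoc,
      Finset.mul_sum]
    congr 1
    exact Finset.sum_congr rfl fun j _ => by ring
  have h2 := h1.smul_const u
  refine h2.congr_fun fun i => ?_
  rw [verma_K_single, map_smul, map_smul, LinearMap.smul_apply, map_smul, coordinate_vermaLift,
    smul_comm (u ⟨k, by omega⟩), ← eq_smul_irrepVec hk hu, smul_smul]

theorem HasTrace.unique {ν : ℂ} (hη : η ≠ 0)
    (hk : ∀ j : ℕ, 1 ≤ j → j ≤ 2 * k → qpow η (2 * j) ≠ 1)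
    (hμ : ∀ l : ℕ, qpow η (2 * (μ - l)) ≠ 1) {ψ ψ' : ℂ}
    (h : HasTrace η ν μ k ψ) (h' : HasTrace η ν μ k ψ') : ψ = ψ' := by
  obtain ⟨Φ, hΦ, hs⟩ := h _ (irrep_K_irrepVec_middle 1)
  obtain ⟨Φ', hΦ', hs'⟩ := h' _ (irrep_K_irrepVec_middle 1)
  obtain rfl := IsIntertwiner.unique hη hk hμ hΦ hΦ'
  have := congrFun (hs.unique hs') ⟨k, by omega⟩
  simpa [irrepVec] using this

end Intertwiner

/-! The explicit form of the renormalized trace function. -/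

theorem prod_Icc_one_eq_prod_range {R : Type*} [CommMonoid R] (f : ℕ → R) (k : ℕ) :
    ∏ j ∈ Finset.Icc 1 k, f j = ∏ l ∈ Finset.range k, f (l + 1) := by
  induction k with
  | zero => simp
  | succ k ih => rw [Finset.prod_Icc_succ_top (by omega), ih, Finset.prod_range_succ]

section Explicit

variable (η : ℂ) (k : ℕ) (μ ν : ℂ)

/-- The polynomial whose coefficients are, up to a common factor, the coefficients of the partial
fraction expansion of the renormalized trace function. -/
def tracePoly : Polynomial ℂ :=
  ∏ l ∈ Finset.range k, ((Polynomial.X - Polynomial.C (qpow η (-2) ^ (l + 1))) *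
    (1 - Polynomial.C (qpow η (-(2 * (μ - l)))) * Polynomial.X))

/-- The renormalized trace function in the form of a partial fraction expansion. -/
def explicitTrace : ℂ :=
  qpow η ((ν + k) * (μ - k)) / (∏ l ∈ Finset.range k, (1 - qpow η (-2) ^ (l + 1))) *
    ∑ s ∈ Finset.range (2 * k + 1), (tracePoly η k μ).coeff s * (1 - qpow η (2 * (s - k - ν)))⁻¹

theorem natDegree_tracePoly_le : (tracePoly η k μ).natDegree ≤ 2 * k := by
  refine (Polynomial.natDegree_prod_le _ _).trans ?_
  refine (Finset.sum_le_card_nsmul _ _ 2 fun l _ => ?_).trans (by simp [mul_comm])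
  compute_degree

theorem eval_tracePoly (x : ℂ) : (tracePoly η k μ).eval x =
    ∏ l ∈ Finset.range k,
      ((x - qpow η (-2) ^ (l + 1)) * (1 - qpow η (-(2 * (μ - l))) * x)) := by
  simp [tracePoly, Polynomial.eval_prod]

theorem sum_tracePoly_coeff (x : ℂ) :
    ∑ s ∈ Finset.range (2 * k + 1), (tracePoly η k μ).coeff s * x ^ s =
      ∏ l ∈ Finset.range k,
        ((x - qpow η (-2) ^ (l + 1)) * (1 - qpow η (-(2 * (μ - l))) * x)) := by
  rw [← eval_tracePoly, Polynomial.eval_eq_sum_range'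
    (Nat.lt_succ_of_le (natDegree_tracePoly_le η k μ))]

theorem differentiable_qpow {f : ℂ → ℂ} (hf : Differentiable ℂ f) :
    Differentiable ℂ fun x => qpow η (f x) := by
  unfold qpow; fun_prop

theorem differentiable_tracePoly_coeff (s : ℕ) :
    Differentiable ℂ fun μ => (tracePoly η k μ).coeff s := by
  have hmul : ∀ f g : ℂ → Polynomial ℂ, (∀ s, Differentiable ℂ fun μ => (f μ).coeff s) →
      (∀ s, Differentiable ℂ fun μ => (g μ).coeff s) →
      ∀ s, Differentiable ℂ fun μ => (f μ * g μ).coeff s := by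
    intro f g hf hg s
    simp only [Polynomial.coeff_mul]
    exact Differentiable.fun_sum fun x _ => (hf x.1).mul (hg x.2)
  induction k generalizing s with
  | zero => simp [tracePoly]
  | succ k ih =>
    simp only [tracePoly, Finset.prod_range_succ]
    refine hmul _ _ ih (hmul _ _ (fun s => differentiable_const _) fun s => ?_) s
    simp only [Polynomial.coeff_sub, Polynomial.coeff_C_mul]
    exact (differentiable_const _).sub ((differentiable_qpow η (by fun_prop)).mul_const _)

/-- The shift `s - k` runs through the integers of absolute value at most `k`, so the poles of the
fractions are exactly the points removed from `regularDomain`. -/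
theorem one_sub_qpow_ne_zero {ν : ℂ} (hν : ν ∈ regularDomain η k) {s : ℕ}
    (hs : s ∈ Finset.range (2 * k + 1)) : 1 - qpow η (2 * (s - k - ν)) ≠ 0 := by
  have hs := Finset.mem_range.1 hs
  intro h
  refine hν ((s : ℤ) - k) (by rw [abs_le]; omega) ?_
  rw [← inv_inj, inv_one, ← qpow_neg, sub_eq_zero.1 h]
  congr 1; push_cast; ring

theorem differentiableOn_explicitTrace :
    DifferentiableOn ℂ (fun ν => explicitTrace η k μ ν) (regularDomain η k) := by
  refine DifferentiableOn.mul ?_ (DifferentiableOn.fun_sum fun s hs => ?_)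
  · exact ((differentiable_qpow η (by fun_prop)).div_const _).differentiableOn
  · refine (differentiableOn_const _).mul (DifferentiableOn.inv ?_ fun ν hν =>
      one_sub_qpow_ne_zero η k hν hs)
    exact ((differentiable_const _).sub (differentiable_qpow η (by fun_prop))).differentiableOn

/-- The denominators do not involve `μ`, and the numerators are polynomials in `q^(-2μ)`. -/
theorem differentiable_explicitTrace : Differentiable ℂ fun μ => explicitTrace η k μ ν := by
  refine Differentiable.mul ((differentiable_qpow η (by fun_prop)).div_const _)
    (Differentiable.fun_sum fun s _ => (differentiable_tracePoly_coeff η k s).mul_const _)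

end Explicit

/-! ### The partial fraction form is the renormalized trace function -/

section Trace

variable {η : ℂ} {k : ℕ} {μ ν : ℂ}

theorem qpow_int_mul (η x : ℂ) (n : ℤ) : qpow η (n * x) = qpow η x ^ n := by
  rw [qpow, qpow, ← Complex.exp_int_mul]; ring_nf

theorem norm_qpow_ofReal (hη : η.re = 0) (x : ℝ) : ‖qpow η x‖ = 1 := by
  rw [qpow, Complex.norm_exp]; simp [hη]

theorem norm_qpow_two_mul_int (hη : η.re = 0) (n : ℤ) : ‖qpow η (2 * n)‖ = 1 := by
  have := norm_qpow_ofReal hη (2 * n)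
  simpa using this

variable (η k μ ν) in
-- In the geometric expansion of the fractions, the coefficient of `z^m` is `tracePoly` evaluated at
-- `p^(-m)`, times `p^(mk)`; this power turns each factor `p^(-m) - p^(l+1)` into `1 - p^(l+1+m)`.
theorem sum_tracePoly_coeff_mul_pow (m : ℕ) : ∑ s ∈ Finset.range (2 * k + 1),
      (tracePoly η k μ).coeff s * qpow η (2 * (s - k - ν)) ^ m =
    (∏ l ∈ Finset.range k, ((1 - qpow η (-2) ^ (l + 1) * qpow η (-2) ^ m) *
        (1 - qpow η (-(2 * (μ - l))) * qpow η (-2) ^ (-m : ℤ)))) * qpow η (-(2 * ν)) ^ m := by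
  have h3 : ∀ s ∈ Finset.range (2 * k + 1),
      (tracePoly η k μ).coeff s * qpow η (2 * (s - k - ν)) ^ m =
      (tracePoly η k μ).coeff s * (qpow η (-2) ^ (-m : ℤ)) ^ s *
        ((qpow η (-2) ^ m) ^ k * qpow η (-(2 * ν)) ^ m) := by
    intro s _
    rw [mul_assoc]
    congr 1
    rw [← zpow_natCast _ s, ← zpow_mul, ← qpow_int_mul, ← pow_mul, ← qpow_nat_mul, ← qpow_nat_mul,
      ← qpow_nat_mul, ← qpow_add, ← qpow_add]
    congr 1; push_cast; ring
  rw [Finset.sum_congr rfl h3, ← Finset.sum_mul, sum_tracePoly_coeff, ← mul_assoc]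
  congr 1
  rw [← Finset.card_range k, ← Finset.prod_const, Finset.card_range, ← Finset.prod_mul_distrib]
  refine Finset.prod_congr rfl fun l _ => ?_
  have h4 : qpow η (-2) ^ (-m : ℤ) * qpow η (-2) ^ m = 1 := by
    rw [zpow_neg, zpow_natCast]
    exact inv_mul_cancel₀ (pow_ne_zero _ (qpow_ne_zero _ _))
  linear_combination (1 - qpow η (-(2 * (μ - l))) * qpow η (-2) ^ (-m : ℤ)) * h4

theorem hasSum_explicitTrace (hη : η.re = 0) (hν : ‖qpow η (-(2 * ν))‖ < 1) :
    HasSum (fun m : ℕ => qpow η ((ν + k) * (μ - k)) /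
      (∏ l ∈ Finset.range k, (1 - qpow η (-2) ^ (l + 1))) *
      ((∏ l ∈ Finset.range k, ((1 - qpow η (-2) ^ (l + 1) * qpow η (-2) ^ m) *
        (1 - qpow η (-(2 * (μ - l))) * qpow η (-2) ^ (-m : ℤ)))) * qpow η (-(2 * ν)) ^ m))
      (explicitTrace η k μ ν) := by
  have h1 : ∀ s : ℕ, HasSum (fun m : ℕ => (qpow η (2 * (s - k - ν))) ^ m)
      (1 - qpow η (2 * (s - k - ν)))⁻¹ := by
    intro s
    refine hasSum_geometric_of_norm_lt_one ?_
    -- Since `|q| = 1`, all the ratios have the same norm as `z`.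
    rw [show 2 * (s - k - ν) = 2 * ((s - k : ℤ) : ℂ) + -(2 * ν) by push_cast; ring, qpow_add,
      norm_mul, norm_qpow_two_mul_int hη, one_mul]
    exact hν
  have h2 := (hasSum_sum fun s (_ : s ∈ Finset.range (2 * k + 1)) =>
    (h1 s).mul_left ((tracePoly η k μ).coeff s)).mul_left (qpow η ((ν + k) * (μ - k)) /
      (∏ l ∈ Finset.range k, (1 - qpow η (-2) ^ (l + 1))))
  refine h2.congr_fun fun m => ?_
  congr 1
  rw [sum_tracePoly_coeff_mul_pow]

/-- The denominators of the trace contribute the factors `1 - p^(-l) z`, `0 ≤ l ≤ j`, and the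
renormalization `1 - p^(l+1) z`, `l < k`. The exponents of `p` are consecutive, from `-j` to `k`, so
a single generating function at `p^(-j) z` covers both. -/
theorem hasSum_qBinom_shift (hη : η.re = 0) (hν : ‖qpow η (-(2 * ν))‖ < 1) (j : ℕ) :
    HasSum (fun m : ℕ => (qpow η (-2) ^ (-(j * (m - j)) : ℤ) *
        qBinom (qpow η (-2)) (m + k) (k + j)) * qpow η (-(2 * ν)) ^ m)
      ((qpow η (-(2 * ν)) ^ j *
        (∏ l ∈ Finset.range (j + 1), (1 - qpow η 2 ^ l * qpow η (-(2 * ν))))⁻¹) *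
        (∏ l ∈ Finset.range k, (1 - qpow η (-2) ^ (l + 1) * qpow η (-(2 * ν))))⁻¹) := by
  set z := qpow η (-(2 * ν)) with hz
  set p := qpow η (-2) with hp
  have hp0 : p ≠ 0 := qpow_ne_zero _ _
  have hQ : qpow η 2 = p⁻¹ := by rw [hp, qpow_neg, inv_inv]
  have hnp : ‖p‖ = 1 := by
    have := norm_qpow_two_mul_int hη (-1)
    rw [hp, ← this]; norm_num
  have h1 : ‖(p⁻¹) ^ j * z‖ < 1 := by simpa [hnp] using hν
  have h2 := ((summable_and_hasSum_qBinom hnp.le h1 (k + j)).2).mul_left (z ^ j)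
  have h3 : z ^ j * (∏ l ∈ Finset.range (k + j + 1), (1 - p ^ l * ((p⁻¹) ^ j * z)))⁻¹ =
      (z ^ j * (∏ l ∈ Finset.range (j + 1), (1 - qpow η 2 ^ l * z))⁻¹) *
        (∏ l ∈ Finset.range k, (1 - p ^ (l + 1) * z))⁻¹ := by
    rw [mul_assoc, ← mul_inv, show k + j + 1 = (j + 1) + k by ring, Finset.prod_range_add, hQ]
    congr 3
    · rw [← Finset.prod_range_reflect]
      refine Finset.prod_congr rfl fun l hl => ?_
      have hl : l ≤ j := Nat.lt_succ_iff.1 (Finset.mem_range.1 hl)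
      obtain ⟨d, rfl⟩ := Nat.exists_eq_add_of_le hl
      rw [show l + d + 1 - 1 - l = d by omega, ← mul_assoc, pow_add p⁻¹ l d,
        mul_comm (p⁻¹ ^ l), ← mul_assoc, ← mul_pow, mul_inv_cancel₀ hp0, one_pow, one_mul]
    · refine Finset.prod_congr rfl fun l _ => ?_
      rw [show j + 1 + l = l + 1 + j by ring, pow_add p (l + 1) j, ← mul_assoc, mul_assoc (p ^ _),
        ← mul_pow, mul_inv_cancel₀ hp0, one_pow, mul_one]
  rw [h3] at h2
  have h4 : HasSum (fun i : ℕ => (p ^ (-(j * ((i + j : ℕ) - j)) : ℤ) *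
      qBinom p (i + j + k) (k + j)) * z ^ (i + j))
      ((z ^ j * (∏ l ∈ Finset.range (j + 1), (1 - qpow η 2 ^ l * z))⁻¹) *
        (∏ l ∈ Finset.range k, (1 - p ^ (l + 1) * z))⁻¹) := by
    refine h2.congr_fun fun i => ?_
    rw [show i + j + k = i + (k + j) by ring, mul_pow, ← pow_mul, inv_pow, ← zpow_natCast p (j * i),
      ← zpow_neg, pow_add z, show (-(j * ((i + j : ℕ) - j)) : ℤ) = -((j * i : ℕ) : ℤ) by
        push_cast; ring]
    ring
  have h5 := (hasSum_nat_add_iff (f := fun m : ℕ => (p ^ (-(j * (m - j)) : ℤ) *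
      qBinom p (m + k) (k + j)) * z ^ m) j).1 h4
  rwa [Finset.sum_eq_zero, add_zero] at h5
  intro i hi
  rw [qBinom_eq_zero p (show i + k < k + j by have := Finset.mem_range.1 hi; omega)]
  ring

theorem one_sub_qpow_pow_ne_zero {j : ℕ} (h : qpow η (2 * j) ≠ 1) : 1 - qpow η (-2) ^ j ≠ 0 := by
  rw [← qpow_nat_mul, show (j * -2 : ℂ) = -(2 * j) by ring, qpow_neg]
  intro h'
  exact h (by rw [← inv_inj, inv_one, ← sub_eq_zero.1 h'])

theorem qnum_eq (η x : ℂ) :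
    qnum η x = qpow η x * (1 - qpow η (-(2 * x))) / (qpow η 1 - qpow η (-1)) := by
  rw [qnum, qpow_sub_qpow_neg]

theorem traceCoeff_succ (hk : ∀ j : ℕ, 1 ≤ j → j ≤ 2 * k → qpow η (2 * j) ≠ 1)
    (hμ : ∀ l : ℕ, qpow η (2 * (μ - l)) ≠ 1) {j : ℕ} (hj : j < k) :
    traceCoeff η μ k (j + 1) * (1 - qpow η (-2) ^ (j + 1)) *
        (1 - qpow η (-(2 * μ)) * qpow η (-2) ^ (-j : ℤ)) =
      -(qpow η (-(2 * μ)) * qpow η (-2) ^ (-(k + j : ℤ))) * (1 - qpow η (-2) ^ (k - j)) *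
        (1 - qpow η (-2) ^ (k + j + 1)) * traceCoeff η μ k j := by
  have hδ : qpow η 1 - qpow η (-1) ≠ 0 :=
    qpow_sub_qpow_neg_ne_zero (by rw [mul_one]; exact qpow_two_ne_one hk (by omega))
  have n1 : 1 - qpow η (-2) ^ (j + 1) ≠ 0 :=
    one_sub_qpow_pow_ne_zero (hk _ (by omega) (by omega))
  have e1 : qpow η (-2) ^ (j + 1) = qpow η (-(2 * (j + 1))) := by
    rw [← qpow_nat_mul]; congr 1; push_cast; ring
  have e2 : qpow η (-(2 * μ)) * qpow η (-2) ^ (-j : ℤ) = qpow η (-(2 * (μ - j))) := by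
    rw [← qpow_int_mul, ← qpow_add]; congr 1; push_cast; ring
  have e3 : qpow η (-2) ^ (k - j) = qpow η (-(2 * (k - j))) := by
    rw [← qpow_nat_mul, Nat.cast_sub hj.le]; congr 1; ring
  have e4 : qpow η (-2) ^ (k + j + 1) = qpow η (-(2 * (k + j + 1))) := by
    rw [← qpow_nat_mul]; congr 1; push_cast; ring
  have n2 : 1 - qpow η (-(2 * (μ - j))) ≠ 0 := by
    rw [qpow_neg]
    intro h'
    exact hμ j (by rw [← inv_inj, inv_one, ← sub_eq_zero.1 h'])
  have e5 : qpow η (-(2 * (j + 1))) * (qpow η (k - j) * qpow η (k + j + 1)) *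
      qpow η (-((j + 1 : ℕ) * (μ - 2 * (j + 1 : ℕ)))) =
      qpow η (-(2 * μ)) * qpow η (-2) ^ (-(k + j : ℤ)) * qpow η (-(j * (μ - 2 * j))) *
        (qpow η (j + 1) * qpow η (μ - j)) := by
    rw [← qpow_int_mul]
    simp only [← qpow_add]
    congr 1; push_cast; ring
  rw [e2, e3, e4, e1]
  rw [e1] at n1
  simp only [traceCoeff, singularCoeff, qnum_eq]
  have m1 := qpow_ne_zero η (j + 1)
  have m2 := qpow_ne_zero η (μ - j)
  set N1 := 1 - qpow η (-(2 * ((j : ℂ) + 1)))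
  set N2 := 1 - qpow η (-(2 * (μ - j)))
  set N3 := 1 - qpow η (-(2 * ((k : ℂ) - j)))
  set N4 := 1 - qpow η (-(2 * ((k : ℂ) + j + 1)))
  set δ := qpow η 1 - qpow η (-1)
  set c := singularCoeff η μ k j
  set a1 := qpow η ((j : ℂ) + 1)
  set a2 := qpow η (μ - j)
  set a3 := qpow η ((k : ℂ) - j)
  set a4 := qpow η ((k : ℂ) + j + 1)
  set b1 := qpow η (-(2 * ((j : ℂ) + 1)))
  set b2 := qpow η (-(((j + 1 : ℕ) : ℂ) * (μ - 2 * ((j + 1 : ℕ) : ℂ))))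
  have : -c * (b1 * (a3 * N3 / δ * (a4 * N4 / δ)) / (a1 * N1 / δ * (a2 * N2 / δ))) * b2 * N1 * N2 =
      -c * N3 * N4 * (b1 * (a3 * a4) * b2) / (a1 * a2) := by
    field_simp
  rw [this, e5]
  field_simp

/-- Both sides are power series in `z`, and `trace_coeff` equates their coefficients. -/
theorem explicitTrace_eq (hη : η.re = 0)
    (hk : ∀ j : ℕ, 1 ≤ j → j ≤ 2 * k → qpow η (2 * j) ≠ 1)
    (hμ : ∀ l : ℕ, qpow η (2 * (μ - l)) ≠ 1) (hν : ‖qpow η (-(2 * ν))‖ < 1) :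
    explicitTrace η k μ ν =
      (∏ j ∈ Finset.Icc 1 k, (qpow η (μ + 1 - j) - qpow η (-μ - 1 + j)) /
        (qpow η (ν + j) - qpow η (-ν - j))) * traceValue η μ k ν := by
  have hP : ∏ l ∈ Finset.range k, (1 - qpow η (-2) ^ (l + 1)) ≠ 0 :=
    Finset.prod_ne_zero_iff.2 fun l hl => one_sub_qpow_pow_ne_zero
      (hk _ (by omega) (by have := Finset.mem_range.1 hl; omega))
  have hM : ∀ l : ℕ, qpow η (-(2 * (μ - l))) = qpow η (-(2 * μ)) * qpow η (-2) ^ (-l : ℤ) := by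
    intro l
    rw [← qpow_int_mul, ← qpow_add]; congr 1; push_cast; ring
  -- Extracting the power `q^(k (μ - ν - k))` writes the renormalizing product in terms of `M`, `p`
  -- and `z`.
  have hpre : ∀ k : ℕ, ∏ j ∈ Finset.Icc 1 k, (qpow η (μ + 1 - j) - qpow η (-μ - 1 + j)) /
        (qpow η (ν + j) - qpow η (-ν - j)) =
      qpow η (k * (μ - ν - k)) *
        ((∏ l ∈ Finset.range k, (1 - qpow η (-(2 * μ)) * qpow η (-2) ^ (-l : ℤ))) *
        (∏ l ∈ Finset.range k, (1 - qpow η (-2) ^ (l + 1) * qpow η (-(2 * ν))))⁻¹) := by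
    intro k
    rw [prod_Icc_one_eq_prod_range]
    induction k with
    | zero => simp [qpow_zero]
    | succ k ih =>
      rw [Finset.prod_range_succ, ih, Finset.prod_range_succ, Finset.prod_range_succ, mul_inv]
      have e1 : qpow η (μ + 1 - (k + 1 : ℕ)) - qpow η (-μ - 1 + (k + 1 : ℕ)) =
          qpow η (μ - k) * (1 - qpow η (-(2 * μ)) * qpow η (-2) ^ (-k : ℤ)) := by
        rw [← hM, ← qpow_sub_qpow_neg]; push_cast; ring_nf
      have e2 : qpow η (ν + (k + 1 : ℕ)) - qpow η (-ν - (k + 1 : ℕ)) =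
          qpow η (ν + (k + 1)) * (1 - qpow η (-2) ^ (k + 1) * qpow η (-(2 * ν))) := by
        rw [← qpow_nat_mul, ← qpow_add, show ((k + 1 : ℕ) * -2 + -(2 * ν) : ℂ) =
          -(2 * (ν + (k + 1))) by push_cast; ring, ← qpow_sub_qpow_neg]; push_cast; ring_nf
      have e3 : qpow η ((k + 1 : ℕ) * (μ - ν - (k + 1 : ℕ))) =
          qpow η (k * (μ - ν - k)) * (qpow η (μ - k) * (qpow η (ν + (k + 1)))⁻¹) := by
        rw [← qpow_neg, ← qpow_add, ← qpow_add]; congr 1; push_cast; ring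
      rw [e1, e2, e3, mul_div_mul_comm, div_eq_mul_inv, div_eq_mul_inv]
      ring
  have h1 := (hasSum_sum fun j (_ : j ∈ Finset.range (k + 1)) =>
    (hasSum_qBinom_shift (k := k) hη hν j).mul_left ((∏ l ∈ Finset.range k,
      (1 - qpow η (-(2 * μ)) * qpow η (-2) ^ (-l : ℤ))) * traceCoeff η μ k j)).mul_left
        (qpow η ((ν + k) * (μ - k)))
  have h2 := hasSum_explicitTrace (k := k) (μ := μ) hη hν
  refine ((h2.congr_fun fun m => ?_).unique h1).trans ?_
  rotate_left
  · rw [hpre, traceValue,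
      show (ν + k) * (μ - k) = ν * μ + k * (μ - ν - k) by ring, qpow_add]
    rw [Finset.mul_sum, Finset.mul_sum, Finset.mul_sum]
    refine Finset.sum_congr rfl fun j _ => ?_
    ring
  · have h4 := trace_coeff (p := qpow η (-2)) (M := qpow η (-(2 * μ))) (k := k)
      (d := traceCoeff η μ k) (qpow_ne_zero _ _)
      (by simp [traceCoeff, singularCoeff, qpow_zero])
      (fun j hj => one_sub_qpow_pow_ne_zero (hk _ (by omega) (by omega)))
      (fun j _ => by
        rw [← hM, qpow_neg]
        intro h'
        exact hμ j (by rw [← inv_inj, inv_one, ← sub_eq_zero.1 h']))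
      (fun j hj => traceCoeff_succ hk hμ hj) m
    simp only [hM]
    rw [← h4, mul_assoc, div_mul_eq_mul_div, mul_left_comm, mul_div_cancel_left₀ _ hP,
      Finset.sum_mul]
    congr 1
    exact Finset.sum_congr rfl fun j _ => by ring

theorem isRenormalizedTrace_explicitTrace (hη : η.re = 0)
    (hk : ∀ j : ℕ, 1 ≤ j → j ≤ 2 * k → qpow η (2 * j) ≠ 1) :
    IsRenormalizedTrace η k fun ν μ => explicitTrace η k μ ν where
  eq_trace μ ν hμ hν := by
    refine ⟨_, hasTrace_traceValue hk hμ ?_ hν, explicitTrace_eq hη hk hμ hν⟩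
    have := norm_qpow_two_mul_int hη 1
    simpa using this.le
  holomorphic_left μ := differentiableOn_explicitTrace η k μ
  holomorphic_right ν _ := differentiable_explicitTrace η k ν

/-! Uniqueness of the analytic continuation. -/

theorem countable_setOf_qpow_eq_one (hη : η ≠ 0) :
    {x : ℂ | ∃ l : ℤ, qpow η (2 * (x - l)) = 1}.Countable := by
  refine (Set.countable_range fun x : ℤ × ℤ =>
    (x.1 : ℂ) + x.2 * (2 * Real.pi * Complex.I) / (2 * η)).mono ?_
  rintro x ⟨l, hl⟩
  obtain ⟨n, hn⟩ := Complex.exp_eq_one_iff.1 hl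
  refine ⟨(l, n), ?_⟩
  dsimp only
  rw [← hn]
  field_simp
  ring

theorem isOpen_regularDomain (η : ℂ) (k : ℕ) : IsOpen (regularDomain η k) := by
  have : regularDomain η k =
      ⋂ l ∈ Set.Icc (-(k : ℤ)) k, {ν : ℂ | qpow η (2 * (ν - l)) ≠ 1} := by
    ext ν
    simp only [regularDomain, Set.mem_ofPred_eq, Set.mem_iInter, Set.mem_Icc, abs_le]
  rw [this]
  refine (Set.finite_Icc _ _).isOpen_biInter fun l _ => isOpen_ne_fun ?_ continuous_const
  exact (differentiable_qpow η (by fun_prop)).continuous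

/-- The complement of a countable subset of the plane is path-connected. -/
theorem isPreconnected_regularDomain (hη : η ≠ 0) (k : ℕ) :
    IsPreconnected (regularDomain η k) := by
  have h : (regularDomain η k)ᶜ.Countable := by
    refine (countable_setOf_qpow_eq_one hη).mono fun ν hν => ?_
    simp only [regularDomain, Set.mem_compl_iff, Set.mem_ofPred_eq, not_forall, not_not] at hν
    obtain ⟨l, _, hl⟩ := hν
    exact ⟨l, hl⟩
  have h2 := h.isPathConnected_compl_of_one_lt_rank (by
    rw [Complex.rank_real_complex]; exact_mod_cast one_lt_two)
  rw [compl_compl] at h2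
  exact h2.isConnected.isPreconnected

theorem mem_regularDomain_of_norm_lt_one (hη : η.re = 0) (hν : ‖qpow η (-(2 * ν))‖ < 1) :
    ν ∈ regularDomain η k := by
  intro l _ h
  have h1 := congrArg norm h
  rw [show 2 * (ν - l) = -(-(2 * ν)) + 2 * ((-l : ℤ) : ℂ) by push_cast; ring, qpow_add, norm_mul,
    norm_qpow_two_mul_int hη, qpow_neg, norm_inv, norm_one, mul_one, inv_eq_one] at h1
  exact hν.ne h1

/-- For generic `μ` the two functions agree where the trace converges, hence on the regular domain
by the identity theorem in `ν`. Generic `μ` are dense, so continuity in `μ` gives the rest. -/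
theorem IsRenormalizedTrace.unique (hη0 : η ≠ 0) (hη : η.re = 0)
    (hk : ∀ j : ℕ, 1 ≤ j → j ≤ 2 * k → qpow η (2 * j) ≠ 1) {Ψ Ψ' : ℂ → ℂ → ℂ}
    (h : IsRenormalizedTrace η k Ψ) (h' : IsRenormalizedTrace η k Ψ')
    (hν : ν ∈ regularDomain η k) (μ : ℂ) : Ψ ν μ = Ψ' ν μ := by
  have key : ∀ μ : ℂ, (∀ l : ℕ, qpow η (2 * (μ - l)) ≠ 1) → Ψ ν μ = Ψ' ν μ := by
    intro μ hμ
    -- The base point `ν = η⁻¹` gives `q^(-2ν) = e^(-2)`, inside the region of convergence.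
    have hlt : ‖qpow η (-(2 * η⁻¹))‖ < 1 := by
      rw [qpow, show η * -(2 * η⁻¹) = -2 by field_simp, Complex.norm_exp]
      simp
    have a1 := (h.holomorphic_left μ).analyticOnNhd (isOpen_regularDomain η k)
    have a2 := (h'.holomorphic_left μ).analyticOnNhd (isOpen_regularDomain η k)
    refine a1.eqOn_of_preconnected_of_eventuallyEq a2 (isPreconnected_regularDomain hη0 k)
      (mem_regularDomain_of_norm_lt_one hη hlt) ?_ hν
    have hc : Continuous fun ν : ℂ => ‖qpow η (-(2 * ν))‖ :=
      (differentiable_qpow η (by fun_prop)).continuous.norm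
    filter_upwards [hc.continuousAt.eventually_lt_const hlt] with x hx
    obtain ⟨ψ, hψ, e⟩ := h.eq_trace μ x hμ hx
    obtain ⟨ψ', hψ', e'⟩ := h'.eq_trace μ x hμ hx
    rw [e, e', hψ.unique hη0 hk hμ hψ']
  have hd : Dense {x : ℂ | ∃ l : ℤ, qpow η (2 * (x - l)) = 1}ᶜ :=
    (countable_setOf_qpow_eq_one hη0).dense_compl ℂ
  have heq := Continuous.ext_on hd (h.holomorphic_right ν hν).continuous
    (h'.holomorphic_right ν hν).continuous fun μ hμ => key μ fun l hl => hμ ⟨l, by simpa using hl⟩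
  exact congrFun heq μ

theorem renormalizedTrace_eq (hη0 : η ≠ 0) (hη : η.re = 0)
    (hk : ∀ j : ℕ, 1 ≤ j → j ≤ 2 * k → qpow η (2 * j) ≠ 1)
    (hν : ν ∈ regularDomain η k) (μ : ℂ) :
    renormalizedTrace η k ν μ = explicitTrace η k μ ν :=
  IsRenormalizedTrace.unique hη0 hη hk
    (Classical.epsilon_spec ⟨_, isRenormalizedTrace_explicitTrace hη hk⟩)
    (isRenormalizedTrace_explicitTrace hη hk) hν μ

end Trace

/-! The Rogers polynomials, and the orthogonality of Macdonald polynomials of type `A₁`. -/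

/-- The numerators of the coefficients of Rogers polynomials. -/
def rogersNum {R : Type*} [CommRing R] (Q : R) (k a b : ℕ) : R :=
  ∏ l ∈ Finset.range k, ((1 - Q ^ (a + l + 1)) * (1 - Q ^ (b + l + 1)))

theorem map_rogersNum {R S : Type*} [CommRing R] [CommRing S] (f : R →+* S) (Q : R) (k a b : ℕ) :
    f (rogersNum Q k a b) = rogersNum (f Q) k a b := by
  simp [rogersNum]

theorem rogersNum_comm {R : Type*} [CommRing R] (Q : R) (k a b : ℕ) :
    rogersNum Q k a b = rogersNum Q k b a :=
  Finset.prod_congr rfl fun _ _ => mul_comm _ _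

section Field

variable {R : Type*} [Field R]

/-- The monic Rogers polynomial with parameter `t = q ^ (2 (k + 1))`. -/
def rogers (q : R) (k N : ℕ) : R[T;T⁻¹] :=
  ∑ j ∈ Finset.range (N + 1),
    LaurentPolynomial.C (rogersNum (q ^ 2) k j (N - j) / rogersNum (q ^ 2) k 0 N) *
      LaurentPolynomial.T ((N : ℤ) - 2 * j)

theorem coeff_C_mul_T (a : R) (n i : ℤ) :
    (LaurentPolynomial.C a * LaurentPolynomial.T n : R[T;T⁻¹]).coeff i = if n = i then a else 0 := by
  rw [← LaurentPolynomial.single_eq_C_mul_T, AddMonoidAlgebra.coeff_single, Finsupp.single_apply]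

theorem coeff_rogers (q : R) (k N : ℕ) (i : ℤ) : (rogers q k N).coeff i =
    ∑ j ∈ Finset.range (N + 1), if (N : ℤ) - 2 * j = i then
      rogersNum (q ^ 2) k j (N - j) / rogersNum (q ^ 2) k 0 N else 0 := by
  rw [rogers, AddMonoidAlgebra.coeff_sum, Finset.sum_apply']
  exact Finset.sum_congr rfl fun j _ => coeff_C_mul_T _ _ _

theorem coeff_rogers_sub (q : R) (k : ℕ) {N j : ℕ} (hj : j ≤ N) :
    (rogers q k N).coeff ((N : ℤ) - 2 * j) =
      rogersNum (q ^ 2) k j (N - j) / rogersNum (q ^ 2) k 0 N := by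
  rw [coeff_rogers, Finset.sum_eq_single j, if_pos rfl]
  · intro i _ hi
    rw [if_neg (by omega)]
  · intro h
    exact absurd (Finset.mem_range.2 (Nat.lt_succ_of_le hj)) h

theorem coeff_rogers_eq_zero (q : R) (k : ℕ) {N : ℕ} {i : ℤ}
    (h : ∀ j : ℕ, j ≤ N → (N : ℤ) - 2 * j ≠ i) : (rogers q k N).coeff i = 0 := by
  rw [coeff_rogers]
  refine Finset.sum_eq_zero fun j hj => if_neg (h j (Nat.lt_succ_iff.1 (Finset.mem_range.1 hj)))

theorem invert_rogers (q : R) (k N : ℕ) :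
    LaurentPolynomial.invert (rogers q k N) = rogers q k N := by
  rw [rogers, map_sum, ← Finset.sum_range_reflect]
  refine Finset.sum_congr rfl fun j hj => ?_
  have hj : j ≤ N := Nat.lt_succ_iff.1 (Finset.mem_range.1 hj)
  rw [map_mul, LaurentPolynomial.invert_C, LaurentPolynomial.invert_T,
    show N + 1 - 1 - j = N - j by omega, show N - (N - j) = j by omega, rogersNum_comm _ _ (N - j)]
  congr 2
  omega

theorem rogersNum_zero_ne_zero {Q : R} (hQ : ∀ j : ℕ, 0 < j → Q ^ j ≠ 1) (k N : ℕ) :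
    rogersNum Q k 0 N ≠ 0 :=
  Finset.prod_ne_zero_iff.2 fun l _ => mul_ne_zero
    (sub_ne_zero.2 (hQ _ (by omega)).symm) (sub_ne_zero.2 (hQ _ (by omega)).symm)

theorem rogers_zero {q : R} (hQ : ∀ j : ℕ, 0 < j → (q ^ 2) ^ j ≠ 1) (k : ℕ) :
    rogers q k 0 = 1 := by
  simp [rogers, div_self (rogersNum_zero_ne_zero hQ k 0)]

theorem coeff_rogers_self {q : R} (hQ : ∀ j : ℕ, 0 < j → (q ^ 2) ^ j ≠ 1) (k N : ℕ) :
    (rogers q k N).coeff N = 1 := by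
  have := coeff_rogers_sub q k (Nat.zero_le N)
  rwa [Nat.sub_zero, div_self (rogersNum_zero_ne_zero hQ k N), Nat.cast_zero, mul_zero,
    sub_zero] at this

theorem coeff_neg_of_invert {f : R[T;T⁻¹]} (h : LaurentPolynomial.invert f = f) (i : ℤ) :
    f.coeff (-i) = f.coeff i := by
  rw [← LaurentPolynomial.invert_apply, h]

/-! Half of the weight. -/

/-- The nonsymmetric weight, whose symmetrization is the weight. -/
def halfWeight (q : R) (k : ℕ) : R[T;T⁻¹] :=
  (1 - LaurentPolynomial.T 2) * ∏ l ∈ Finset.range k,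
    ((1 - LaurentPolynomial.C ((q ^ 2) ^ (l + 1)) * LaurentPolynomial.T 2) *
      (1 - LaurentPolynomial.C ((q ^ 2) ^ (l + 1)) * LaurentPolynomial.T (-2)))

theorem invert_halfWeight (q : R) (k : ℕ) :
    LaurentPolynomial.invert (halfWeight q k) = (1 - LaurentPolynomial.T (-2)) *
      ∏ l ∈ Finset.range k,
        ((1 - LaurentPolynomial.C ((q ^ 2) ^ (l + 1)) * LaurentPolynomial.T 2) *
          (1 - LaurentPolynomial.C ((q ^ 2) ^ (l + 1)) * LaurentPolynomial.T (-2))) := by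
  rw [halfWeight, map_mul, map_prod, map_sub, map_one, LaurentPolynomial.invert_T]
  congr 1
  refine Finset.prod_congr rfl fun l _ => ?_
  rw [map_mul, map_sub, map_sub, map_one, map_mul, map_mul, LaurentPolynomial.invert_C,
    LaurentPolynomial.invert_T, LaurentPolynomial.invert_T, neg_neg, mul_comm]

/-- The factor of index zero splits by `(1 - T²)(1 - T⁻²) = (1 - T²) + (1 - T⁻²)`, and the other
factors are symmetric. -/
theorem macdonaldWeight_eq_add (q : R) (k : ℕ) :
    macdonaldWeight q (k + 1) = halfWeight q k + LaurentPolynomial.invert (halfWeight q k) := by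
  have h : (LaurentPolynomial.T 2 * LaurentPolynomial.T (-2) : R[T;T⁻¹]) = 1 := by
    rw [← LaurentPolynomial.T_add]; rfl
  have h2 : macdonaldWeight q (k + 1) =
      (1 - LaurentPolynomial.T 2) * (1 - LaurentPolynomial.T (-2)) * ∏ l ∈ Finset.range k,
        ((1 - LaurentPolynomial.C ((q ^ 2) ^ (l + 1)) * LaurentPolynomial.T 2) *
          (1 - LaurentPolynomial.C ((q ^ 2) ^ (l + 1)) * LaurentPolynomial.T (-2))) := by
    rw [macdonaldWeight, Finset.prod_range_succ', mul_zero, pow_zero, map_one, one_mul, one_mul,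
      mul_comm]
    congr 1
    refine Finset.prod_congr rfl fun l _ => ?_
    rw [pow_mul]
  rw [invert_halfWeight, halfWeight, h2]
  set A : R[T;T⁻¹] := ∏ l ∈ Finset.range k,
    ((1 - LaurentPolynomial.C ((q ^ 2) ^ (l + 1)) * LaurentPolynomial.T 2) *
      (1 - LaurentPolynomial.C ((q ^ 2) ^ (l + 1)) * LaurentPolynomial.T (-2)))
  linear_combination A * h

/-- Inversion preserves constant terms, so both halves of the weight contribute equally and the
factor one half disappears. -/
theorem macdonaldForm_eq (h2 : (2 : R) ≠ 0) (q : R) (k : ℕ) {f g : R[T;T⁻¹]}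
    (hf : LaurentPolynomial.invert f = f) (hg : LaurentPolynomial.invert g = g) :
    macdonaldForm q (k + 1) f g = (f * g * halfWeight q k).coeff 0 := by
  have h : (f * g * LaurentPolynomial.invert (halfWeight q k)).coeff 0 =
      (f * g * halfWeight q k).coeff 0 := by
    have : f * g * LaurentPolynomial.invert (halfWeight q k) =
        LaurentPolynomial.invert (f * g * halfWeight q k) := by
      rw [map_mul, map_mul, hf, hg]
    rw [this, LaurentPolynomial.invert_apply, neg_zero]
  rw [macdonaldForm, macdonaldWeight_eq_add, mul_add, AddMonoidAlgebra.coeff_add,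
    Finsupp.add_apply, h]
  field_simp
  ring

/-- The polynomial with the coefficients of the nonsymmetric weight, up to a factor. -/
def weightPoly (Q : R) (k : ℕ) : Polynomial R :=
  ∏ l ∈ Finset.range (2 * k + 1), (1 - Polynomial.C (Q ^ ((l : ℤ) - k)) * Polynomial.X)

theorem natDegree_weightPoly_le (Q : R) (k : ℕ) : (weightPoly Q k).natDegree ≤ 2 * k + 1 := by
  refine (Polynomial.natDegree_prod_le _ _).trans ?_
  refine (Finset.sum_le_card_nsmul _ _ 1 fun l _ => ?_).trans (by simp)
  compute_degree

theorem coeff_weightPoly_ne_zero {Q : R} (hQ : Q ≠ 0) (k : ℕ) :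
    (weightPoly Q k).coeff (2 * k + 1) ≠ 0 := by
  have h := Polynomial.coeff_prod_of_natDegree_le (R := R) (s := Finset.range (2 * k + 1))
    (f := fun l => 1 - Polynomial.C (Q ^ ((l : ℤ) - k)) * Polynomial.X) (n := 1)
    (fun l _ => by compute_degree)
  rw [Finset.card_range, mul_one] at h
  rw [weightPoly, h, Finset.prod_ne_zero_iff]
  intro l _
  simp [Polynomial.coeff_one, zpow_ne_zero _ hQ]

/-- Extracting `-Q^(l+1) T⁻²` from `1 - Q^(l+1) T⁻²` leaves `1 - Q^(-l-1) T²`. Together with `1 -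
T²` and the other half, the exponents of `Q` then run from `-k` to `k`, as in `weightPoly`. -/
theorem halfWeight_eq {q : R} (hq : q ≠ 0) (k : ℕ) :
    halfWeight q k = ∑ i ∈ Finset.range (2 * k + 2),
      LaurentPolynomial.C ((∏ l ∈ Finset.range k, (-(q ^ 2) ^ (l + 1))) *
        (weightPoly (q ^ 2) k).coeff i) * LaurentPolynomial.T (2 * i - 2 * k) := by
  set Q := q ^ 2 with hQ
  have hQ0 : Q ≠ 0 := pow_ne_zero _ hq
  have h1 : (weightPoly Q k).eval₂ LaurentPolynomial.C (LaurentPolynomial.T 2) =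
      ∏ l ∈ Finset.range (2 * k + 1),
        (1 - LaurentPolynomial.C (Q ^ ((l : ℤ) - k)) * LaurentPolynomial.T 2) := by
    rw [weightPoly, Polynomial.eval₂_finsetProd]
    simp
  have h2 : halfWeight q k = LaurentPolynomial.C (∏ l ∈ Finset.range k, (-Q ^ (l + 1))) *
      LaurentPolynomial.T (-(2 * k)) *
      (weightPoly Q k).eval₂ LaurentPolynomial.C (LaurentPolynomial.T 2) := by
    have h3 : ∏ l ∈ Finset.range k,
        (1 - LaurentPolynomial.C (Q ^ (l + 1)) * LaurentPolynomial.T (-2) : R[T;T⁻¹]) =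
        LaurentPolynomial.C (∏ l ∈ Finset.range k, (-Q ^ (l + 1))) *
        LaurentPolynomial.T (-(2 * k)) * ∏ l ∈ Finset.range k,
          (1 - LaurentPolynomial.C (Q ^ (-(l + 1 : ℤ))) * LaurentPolynomial.T 2) := by
      have h4 : (LaurentPolynomial.T (-(2 * k)) : R[T;T⁻¹]) =
          ∏ l ∈ Finset.range k, LaurentPolynomial.T (-2) := by
        rw [Finset.prod_const, Finset.card_range, LaurentPolynomial.T_pow]; congr 1; ring
      rw [h4, map_prod, ← Finset.prod_mul_distrib, ← Finset.prod_mul_distrib]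
      refine Finset.prod_congr rfl fun l _ => ?_
      have h5 : (LaurentPolynomial.C (Q ^ (l + 1)) * LaurentPolynomial.C (Q ^ (-(l + 1 : ℤ))) :
          R[T;T⁻¹]) = 1 := by
        rw [← map_mul, ← zpow_natCast, ← zpow_add₀ hQ0]
        simp
      have h6 : (LaurentPolynomial.T 2 * LaurentPolynomial.T (-2) : R[T;T⁻¹]) = 1 := by
        rw [← LaurentPolynomial.T_add]; rfl
      rw [map_neg]
      linear_combination (-1 : R[T;T⁻¹]) * h5 - (LaurentPolynomial.C (Q ^ (l + 1)) *
        LaurentPolynomial.C (Q ^ (-(l + 1 : ℤ)))) * h6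
    rw [halfWeight, Finset.prod_mul_distrib, h3, h1, show 2 * k + 1 = k + (1 + k) by ring,
      Finset.prod_range_add, Finset.prod_range_add, Finset.prod_range_one,
      ← Finset.prod_range_reflect (fun l => (1 - LaurentPolynomial.C (Q ^ (((l : ℕ) : ℤ) - k)) *
        LaurentPolynomial.T 2 : R[T;T⁻¹]))]
    have e1 : ∀ l ∈ Finset.range k, (1 - LaurentPolynomial.C (Q ^ (((k - 1 - l : ℕ) : ℤ) - k)) *
        LaurentPolynomial.T 2 : R[T;T⁻¹]) =
        1 - LaurentPolynomial.C (Q ^ (-(l + 1 : ℤ))) * LaurentPolynomial.T 2 := by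
      intro l hl
      have := Finset.mem_range.1 hl
      congr 4; omega
    have e2 : ∀ l ∈ Finset.range k, (1 - LaurentPolynomial.C (Q ^ (((k + (1 + l) : ℕ) : ℤ) - k)) *
        LaurentPolynomial.T 2 : R[T;T⁻¹]) =
        1 - LaurentPolynomial.C (Q ^ (l + 1)) * LaurentPolynomial.T 2 := by
      intro l _
      rw [← zpow_natCast]
      congr 4; push_cast; ring
    rw [Finset.prod_congr rfl e1, Finset.prod_congr rfl e2]
    simp only [add_zero, sub_self, zpow_zero, map_one, one_mul]
    ring
  rw [h2, Polynomial.eval₂_eq_sum_range' _ (Nat.lt_succ_of_le (natDegree_weightPoly_le Q k)),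
    Finset.mul_sum]
  refine Finset.sum_congr rfl fun i _ => ?_
  rw [map_mul, LaurentPolynomial.T_pow, show (2 * i - 2 * k : ℤ) = -(2 * k) + i * 2 by ring,
    LaurentPolynomial.T_add]
  ring

/-! Orthogonality. -/

/-- The function that interpolates the numerators of the coefficients of Rogers polynomials. -/
def rogersInterp (Q : R) (k N : ℕ) (j : ℤ) : R :=
  ∏ l ∈ Finset.range k, ((1 - Q ^ (j + l + 1)) * (1 - Q ^ (N - j + l + 1)))

theorem rogersInterp_natCast (Q : R) (k : ℕ) {N j : ℕ} (hj : j ≤ N) :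
    rogersInterp Q k N j = rogersNum Q k j (N - j) := by
  refine Finset.prod_congr rfl fun l _ => ?_
  rw [← zpow_natCast, ← zpow_natCast]
  push_cast [hj]
  rfl

/-- The product formula extends the coefficient sequence by zero for `k` steps beyond each end, the
margin that the convolution with the weight requires. -/
theorem rogersInterp_eq_zero (Q : R) (k N : ℕ) {j : ℤ} (h1 : -(k : ℤ) ≤ j) (h2 : j ≤ N + k)
    (h3 : j < 0 ∨ N < j) : rogersInterp Q k N j = 0 := by
  rcases h3 with h | h
  · refine Finset.prod_eq_zero (i := (-j - 1).toNat) (Finset.mem_range.2 (by omega)) ?_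
    rw [show j + ((-j - 1).toNat : ℤ) + 1 = 0 by omega]
    simp
  · refine Finset.prod_eq_zero (i := (j - N - 1).toNat) (Finset.mem_range.2 (by omega)) ?_
    rw [show N - j + ((j - N - 1).toNat : ℤ) + 1 = 0 by omega]
    simp

/-- As a function of `j`, `rogersInterp` is a combination of the exponentials `Q^(js)`, `|s| ≤ k`,
and each `Q^s` with `|s| ≤ k` is a root of `weightPoly`. -/
theorem sum_weightPoly_mul_rogersInterp {Q : R} (hQ : Q ≠ 0) (k N : ℕ) (c : ℤ) :
    ∑ i ∈ Finset.range (2 * k + 2), (weightPoly Q k).coeff i * rogersInterp Q k N (i + c) = 0 := by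
  set p : Polynomial R := ∏ l ∈ Finset.range k, ((1 - Polynomial.C (Q ^ (l + 1)) * Polynomial.X) *
    (Polynomial.X - Polynomial.C (Q ^ (N + l + 1)))) with hp
  have hdeg : p.natDegree ≤ 2 * k := by
    refine (Polynomial.natDegree_prod_le _ _).trans ?_
    refine (Finset.sum_le_card_nsmul _ _ 2 fun l _ => ?_).trans (by simp [mul_comm])
    compute_degree
  have h1 : ∀ j : ℤ, rogersInterp Q k N j =
      ∑ s ∈ Finset.range (2 * k + 1), p.coeff s * Q ^ (j * (s - k)) := by
    intro j
    have h2 : p.eval (Q ^ j) = rogersInterp Q k N j * Q ^ (j * k) := by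
      rw [hp, Polynomial.eval_prod, rogersInterp, zpow_mul, zpow_natCast,
        ← Finset.card_range k, ← Finset.prod_const, Finset.card_range, ← Finset.prod_mul_distrib]
      refine Finset.prod_congr rfl fun l _ => ?_
      simp only [Polynomial.eval_mul, Polynomial.eval_sub, Polynomial.eval_one, Polynomial.eval_C,
        Polynomial.eval_X]
      have e1 : Q ^ (j + l + 1) = Q ^ (l + 1) * Q ^ j := by
        rw [← zpow_natCast, ← zpow_add₀ hQ]; congr 1; push_cast; ring
      have e2 : Q ^ (N - j + l + 1) * Q ^ j = Q ^ (N + l + 1) := by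
        rw [← zpow_natCast Q (N + l + 1), ← zpow_add₀ hQ]; congr 1; push_cast; ring
      rw [e1]
      linear_combination (1 - Q ^ (l + 1) * Q ^ j) * e2
    rw [Polynomial.eval_eq_sum_range' (Nat.lt_succ_of_le hdeg)] at h2
    have h3 : Q ^ (j * k) * Q ^ (-(j * k)) = 1 := by
      rw [← zpow_add₀ hQ, add_neg_cancel, zpow_zero]
    rw [← mul_one (rogersInterp Q k N j), ← h3, ← mul_assoc, ← h2, Finset.sum_mul]
    refine Finset.sum_congr rfl fun s _ => ?_
    rw [mul_assoc, ← zpow_natCast, ← zpow_mul, ← zpow_add₀ hQ]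
    congr 2; ring
  have h4 : ∀ s ∈ Finset.range (2 * k + 1),
      ∑ i ∈ Finset.range (2 * k + 2), (weightPoly Q k).coeff i * (Q ^ ((s : ℤ) - k)) ^ i = 0 := by
    intro s hs
    rw [← Polynomial.eval_eq_sum_range' (Nat.lt_succ_of_le (natDegree_weightPoly_le Q k)),
      weightPoly, Polynomial.eval_prod]
    have hs := Finset.mem_range.1 hs
    refine Finset.prod_eq_zero (i := 2 * k - s) (Finset.mem_range.2 (by omega)) ?_
    simp only [Polynomial.eval_sub, Polynomial.eval_one, Polynomial.eval_mul, Polynomial.eval_C,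
      Polynomial.eval_X]
    rw [← zpow_add₀ hQ, show ((2 * k - s : ℕ) - k + ((s : ℤ) - k) : ℤ) = 0 by omega, zpow_zero,
      sub_self]
  simp only [h1, Finset.mul_sum]
  rw [Finset.sum_comm]
  refine Finset.sum_eq_zero fun s hs => ?_
  rw [← mul_zero (p.coeff s * Q ^ (c * (s - k))), ← h4 s hs, Finset.mul_sum]
  refine Finset.sum_congr rfl fun i _ => ?_
  rw [← zpow_natCast, ← zpow_mul, add_mul, zpow_add₀ hQ, mul_comm ((s : ℤ) - k)]
  ring

theorem coeff_rogers_mul_T_mul_halfWeight {q : R} (hq : q ≠ 0) (k N : ℕ) (s : ℤ) :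
    (rogers q k N * LaurentPolynomial.T s * halfWeight q k).coeff 0 =
      ∑ i ∈ Finset.range (2 * k + 2), ((∏ l ∈ Finset.range k, (-(q ^ 2) ^ (l + 1))) *
        (weightPoly (q ^ 2) k).coeff i) * (rogers q k N).coeff (2 * k - 2 * i - s) := by
  rw [halfWeight_eq hq, Finset.mul_sum, AddMonoidAlgebra.coeff_sum, Finset.sum_apply']
  refine Finset.sum_congr rfl fun i _ => ?_
  rw [rogers, Finset.sum_mul, Finset.sum_mul, AddMonoidAlgebra.coeff_sum, Finset.sum_apply',
    AddMonoidAlgebra.coeff_sum, Finset.sum_apply', Finset.mul_sum]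
  refine Finset.sum_congr rfl fun j _ => ?_
  rw [coeff_C_mul_T]
  set a := rogersNum (q ^ 2) k j (N - j) / rogersNum (q ^ 2) k 0 N
  set v := (∏ l ∈ Finset.range k, (-(q ^ 2) ^ (l + 1))) * (weightPoly (q ^ 2) k).coeff i
  have : (LaurentPolynomial.C a * LaurentPolynomial.T ((N : ℤ) - 2 * j) * LaurentPolynomial.T s *
      (LaurentPolynomial.C v * LaurentPolynomial.T (2 * (i : ℤ) - 2 * k)) : R[T;T⁻¹]) =
      LaurentPolynomial.C (v * a) *
        LaurentPolynomial.T (((N : ℤ) - 2 * j) + s + (2 * (i : ℤ) - 2 * k)) := by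
    rw [LaurentPolynomial.T_add, LaurentPolynomial.T_add, map_mul LaurentPolynomial.C v a]; ring
  rw [this, coeff_C_mul_T]
  by_cases h : (N : ℤ) - 2 * j = 2 * k - 2 * i - s
  · rw [if_pos h, if_pos (by omega)]
  · rw [if_neg h, if_neg (by omega), mul_zero]

theorem coeff_rogers_eq_rogersInterp (q : R) (k N : ℕ) {j : ℤ} (h1 : -(k : ℤ) ≤ j)
    (h2 : j ≤ N + k) : (rogers q k N).coeff (N - 2 * j) =
      rogersInterp (q ^ 2) k N j / rogersNum (q ^ 2) k 0 N := by
  by_cases h3 : j < 0 ∨ N < j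
  · rw [rogersInterp_eq_zero _ _ _ h1 h2 h3, zero_div]
    exact coeff_rogers_eq_zero _ _ fun i hi => by omega
  · obtain ⟨i, rfl⟩ := Int.eq_ofNat_of_zero_le (show 0 ≤ j by omega)
    rw [coeff_rogers_sub _ _ (by omega), rogersInterp_natCast _ _ (by omega)]

/-- If `s` has the parity of `N`, the `2k + 2` indices met by the weight lie between `-k` and `N +
k`, where `rogersInterp` gives the true coefficients. For the other parity every term is zero. -/
theorem coeff_rogers_mul_T_mul_halfWeight_eq_zero {q : R} (hq : q ≠ 0) (k N : ℕ) {s : ℤ}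
    (h1 : -(N : ℤ) ≤ s) (h2 : s < N) :
    (rogers q k N * LaurentPolynomial.T s * halfWeight q k).coeff 0 = 0 := by
  rw [coeff_rogers_mul_T_mul_halfWeight hq]
  rcases Int.even_or_odd' (N + s) with ⟨h, hs | hs⟩
  · have h4 := sum_weightPoly_mul_rogersInterp (pow_ne_zero 2 hq) k N (h - k)
    rw [← mul_zero ((∏ l ∈ Finset.range k, (-(q ^ 2) ^ (l + 1))) / rogersNum (q ^ 2) k 0 N), ← h4,
      Finset.mul_sum]
    refine Finset.sum_congr rfl fun i hi => ?_
    have hi := Finset.mem_range.1 hi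
    rw [show 2 * k - 2 * i - s = N - 2 * (i + (h - k)) by omega,
      coeff_rogers_eq_rogersInterp _ _ _ (by omega) (by omega)]
    ring
  · refine Finset.sum_eq_zero fun i _ => ?_
    rw [coeff_rogers_eq_zero, mul_zero]
    intro j _
    omega

/-- For `s = N` the window reaches one index too far, to `N + k + 1`. There the coefficient is zero
but `rogersInterp` is not, so the annihilated sum leaves one nonzero term. -/
theorem coeff_rogers_mul_T_mul_halfWeight_ne_zero {q : R} (hq : q ≠ 0)
    (hQ : ∀ j : ℕ, 0 < j → (q ^ 2) ^ j ≠ 1) (k N : ℕ) :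
    (rogers q k N * LaurentPolynomial.T N * halfWeight q k).coeff 0 ≠ 0 := by
  have hQ0 : q ^ 2 ≠ 0 := pow_ne_zero 2 hq
  have h4 := sum_weightPoly_mul_rogersInterp hQ0 k N (N - k)
  rw [Finset.sum_range_succ] at h4
  rw [coeff_rogers_mul_T_mul_halfWeight hq, Finset.sum_range_succ,
    coeff_rogers_eq_zero (i := 2 * k - 2 * ((2 * k + 1 : ℕ) : ℤ) - N), mul_zero, add_zero]
  · have h5 : ∀ i ∈ Finset.range (2 * k + 1), ((∏ l ∈ Finset.range k, (-(q ^ 2) ^ (l + 1))) *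
        (weightPoly (q ^ 2) k).coeff i) * (rogers q k N).coeff (2 * k - 2 * i - N) =
        (∏ l ∈ Finset.range k, (-(q ^ 2) ^ (l + 1))) / rogersNum (q ^ 2) k 0 N *
          ((weightPoly (q ^ 2) k).coeff i * rogersInterp (q ^ 2) k N (i + (N - k))) := by
      intro i hi
      have hi := Finset.mem_range.1 hi
      rw [show 2 * k - 2 * i - N = (N - 2 * (i + (N - k)) : ℤ) by omega,
        coeff_rogers_eq_rogersInterp _ _ _ (by omega) (by omega)]
      ring
    rw [Finset.sum_congr rfl h5, ← Finset.mul_sum, eq_neg_of_add_eq_zero_left h4]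
    refine mul_ne_zero (div_ne_zero ?_ (rogersNum_zero_ne_zero hQ k N))
      (neg_ne_zero.2 (mul_ne_zero (coeff_weightPoly_ne_zero hQ0 k) ?_))
    · exact Finset.prod_ne_zero_iff.2 fun l _ => neg_ne_zero.2 (pow_ne_zero _ hQ0)
    · refine Finset.prod_ne_zero_iff.2 fun l hl => ?_
      have hl := Finset.mem_range.1 hl
      refine mul_ne_zero (sub_ne_zero.2 fun h => ?_) (sub_ne_zero.2 fun h => ?_)
      · refine hQ (N + k + l + 2) (by omega) ?_
        rw [h, ← zpow_natCast]; congr 1; push_cast; ring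
      · refine hQ (k - l) (by omega) ?_
        rw [← inv_inj, inv_one, h, ← zpow_natCast, ← zpow_neg]; congr 1; omega
  · intro j hj
    omega

theorem coeff_rogers_mul_rogers (q : R) (k m n : ℕ) :
    (rogers q k m * rogers q k n * halfWeight q k).coeff 0 = ∑ j ∈ Finset.range (m + 1),
      rogersNum (q ^ 2) k j (m - j) / rogersNum (q ^ 2) k 0 m *
        (rogers q k n * LaurentPolynomial.T ((m : ℤ) - 2 * j) * halfWeight q k).coeff 0 := by
  conv_lhs => rw [rogers]
  rw [Finset.sum_mul, Finset.sum_mul, AddMonoidAlgebra.coeff_sum, Finset.sum_apply']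
  refine Finset.sum_congr rfl fun j _ => ?_
  rw [← smul_eq_mul (_ / _), ← AddMonoidAlgebra.coeff_smul_apply, LaurentPolynomial.smul_eq_C_mul]
  congr 2
  ring

/-! ### The Rogers polynomials are the Macdonald family -/

theorem macdonaldForm_comm (q : R) (k : ℕ) (f g : R[T;T⁻¹]) :
    macdonaldForm q k f g = macdonaldForm q k g f := by
  rw [macdonaldForm, macdonaldForm, mul_comm f]

theorem macdonaldForm_sub_left (q : R) (k : ℕ) (f f' g : R[T;T⁻¹]) :
    macdonaldForm q k (f - f') g = macdonaldForm q k f g - macdonaldForm q k f' g := by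
  rw [macdonaldForm, macdonaldForm, macdonaldForm, sub_mul, sub_mul, ← mul_sub]; rfl

theorem macdonaldForm_C_mul_left (q : R) (k : ℕ) (a : R) (f g : R[T;T⁻¹]) :
    macdonaldForm q k (LaurentPolynomial.C a * f) g = a * macdonaldForm q k f g := by
  rw [macdonaldForm, macdonaldForm, mul_assoc, mul_assoc, ← LaurentPolynomial.smul_eq_C_mul,
    AddMonoidAlgebra.coeff_smul_apply, smul_eq_mul, mul_assoc f]
  ring

theorem macdonaldForm_rogers_eq_zero (h2 : (2 : R) ≠ 0) {q : R} (hq : q ≠ 0) (k : ℕ) {m n : ℕ}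
    (h : m ≠ n) : macdonaldForm q (k + 1) (rogers q k m) (rogers q k n) = 0 := by
  wlog hmn : m < n generalizing m n
  · rw [macdonaldForm_comm]
    exact this h.symm (by omega)
  rw [macdonaldForm_eq h2 _ _ (invert_rogers _ _ _) (invert_rogers _ _ _), coeff_rogers_mul_rogers]
  refine Finset.sum_eq_zero fun j hj => ?_
  have hj := Finset.mem_range.1 hj
  rw [coeff_rogers_mul_T_mul_halfWeight_eq_zero hq _ _ (by omega) (by omega), mul_zero]

theorem macdonaldForm_rogers_self_ne_zero (h2 : (2 : R) ≠ 0) {q : R} (hq : q ≠ 0)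
    (hQ : ∀ j : ℕ, 0 < j → (q ^ 2) ^ j ≠ 1) (k n : ℕ) :
    macdonaldForm q (k + 1) (rogers q k n) (rogers q k n) ≠ 0 := by
  rw [macdonaldForm_eq h2 _ _ (invert_rogers _ _ _) (invert_rogers _ _ _), coeff_rogers_mul_rogers,
    Finset.sum_range_succ', Finset.sum_eq_zero, zero_add]
  · rw [Nat.sub_zero, div_self (rogersNum_zero_ne_zero hQ k n), one_mul, Nat.cast_zero, mul_zero,
      sub_zero]
    exact coeff_rogers_mul_T_mul_halfWeight_ne_zero hq hQ k n
  · intro j hj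
    have hj := Finset.mem_range.1 hj
    rw [coeff_rogers_mul_T_mul_halfWeight_eq_zero hq _ _ (by omega) (by omega), mul_zero]

theorem isMacdonaldFamily_rogers (h2 : (2 : R) ≠ 0) {q : R} (hq : q ≠ 0)
    (hQ : ∀ j : ℕ, 0 < j → (q ^ 2) ^ j ≠ 1) (k : ℕ) :
    IsMacdonaldFamily q (k + 1) (rogers q k) where
  even := invert_rogers q k
  zero := rogers_zero hQ k
  leading n hn i hi := by
    rw [AddMonoidAlgebra.coeff_add, Finsupp.add_apply, LaurentPolynomial.T_apply,
      LaurentPolynomial.T_apply]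
    by_cases h : (n : ℤ) = i
    · rw [if_pos h, if_neg (by omega), ← h, coeff_rogers_self hQ, add_zero]
    · by_cases h' : -(n : ℤ) = i
      · rw [if_neg h, if_pos h', ← h', coeff_neg_of_invert (invert_rogers q k n),
          coeff_rogers_self hQ, zero_add]
      · rw [if_neg h, if_neg h', add_zero]
        refine coeff_rogers_eq_zero _ _ fun j hj hji => ?_
        rw [← hji, le_abs] at hi
        omega
  orthogonal m n h := macdonaldForm_rogers_eq_zero h2 hq k h

/-- Subtracting the multiple of the top Rogers polynomial lowers the degree and keeps orthogonality
to the lower ones, so the remainder vanishes by induction. The nonzero norm then kills the multiple.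
-/
theorem eq_zero_of_orthogonal_rogers (h2 : (2 : R) ≠ 0) {q : R} (hq : q ≠ 0)
    (hQ : ∀ j : ℕ, 0 < j → (q ^ 2) ^ j ≠ 1) (k n : ℕ) {f : R[T;T⁻¹]}
    (hf : LaurentPolynomial.invert f = f) (hd : ∀ i : ℤ, (n : ℤ) ≤ |i| → f.coeff i = 0)
    (ho : ∀ m < n, macdonaldForm q (k + 1) f (rogers q k m) = 0) : f = 0 := by
  induction n generalizing f with
  | zero => exact LaurentPolynomial.ext fun i => hd i (by simp)
  | succ n ih =>
    have hfam := isMacdonaldFamily_rogers h2 hq hQ k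
    have key : f - LaurentPolynomial.C (f.coeff n) * rogers q k n = 0 := by
      have hcoeff : ∀ i : ℤ, (f - LaurentPolynomial.C (f.coeff n) * rogers q k n).coeff i =
          f.coeff i - f.coeff n * (rogers q k n).coeff i := by
        intro i
        rw [← LaurentPolynomial.smul_eq_C_mul]; rfl
      refine ih ?_ (fun i hi => ?_) fun m hm => ?_
      · rw [map_sub, map_mul, LaurentPolynomial.invert_C, hf, invert_rogers]
      · rw [hcoeff]
        rcases hi.lt_or_eq with hi | hi
        · rw [hd i (by omega), coeff_rogers_eq_zero, mul_zero, sub_zero]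
          intro j hj hji
          rw [← hji, lt_abs] at hi
          omega
        · rcases abs_choice i with h | h
          · rw [← h, ← hi, coeff_rogers_self hQ]; ring
          · rw [show i = -(n : ℤ) by omega, coeff_neg_of_invert hf,
              coeff_neg_of_invert (invert_rogers q k n), coeff_rogers_self hQ]; ring
      · rw [macdonaldForm_sub_left, macdonaldForm_C_mul_left, ho m (by omega),
          hfam.orthogonal n m (by omega), mul_zero, sub_zero]
    have h0 := ho n (Nat.lt_succ_self n)
    rw [sub_eq_zero.1 key, macdonaldForm_C_mul_left] at h0
    have h1 := (mul_eq_zero.1 h0).resolve_right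
      (macdonaldForm_rogers_self_ne_zero h2 hq hQ k n)
    rw [sub_eq_zero.1 key, h1, map_zero, zero_mul]

theorem IsMacdonaldFamily.eq_rogers (h2 : (2 : R) ≠ 0) {q : R} (hq : q ≠ 0)
    (hQ : ∀ j : ℕ, 0 < j → (q ^ 2) ^ j ≠ 1) {k : ℕ} {P : ℕ → R[T;T⁻¹]}
    (hP : IsMacdonaldFamily q (k + 1) P) (n : ℕ) : P n = rogers q k n := by
  have hfam := isMacdonaldFamily_rogers h2 hq hQ k
  induction n using Nat.strong_induction_on with
  | _ n ih =>
    rcases Nat.eq_zero_or_pos n with rfl | hn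
    · rw [hP.zero, hfam.zero]
    · refine sub_eq_zero.1 (eq_zero_of_orthogonal_rogers h2 hq hQ k n ?_ (fun i hi => ?_) ?_)
      · rw [map_sub, hP.even, hfam.even]
      · have : (P n - rogers q k n).coeff i = (P n).coeff i - (rogers q k n).coeff i := rfl
        rw [this, hP.leading n hn i hi, hfam.leading n hn i hi, sub_self]
      · intro m hm
        rw [macdonaldForm_sub_left, hfam.orthogonal n m hm.ne', ← ih m hm,
          hP.orthogonal n m hm.ne', sub_zero]

end Field

/-! Macdonald polynomials for an indeterminate `q`, and their specialization. -/

theorem ratFunc_X_pow_ne_one {j : ℕ} (hj : 0 < j) : ((RatFunc.X : RatFunc ℂ) ^ 2) ^ j ≠ 1 := by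
  intro h
  rw [← pow_mul, ← RatFunc.algebraMap_X, ← map_pow, ← map_one (algebraMap (Polynomial ℂ) _)] at h
  have h2 := congrArg Polynomial.natDegree (RatFunc.algebraMap_injective ℂ h)
  rw [Polynomial.natDegree_X_pow, Polynomial.natDegree_one] at h2
  omega

theorem macdonald_eq_rogers (k n : ℕ) : macdonald (k + 1) n = rogers RatFunc.X k n :=
  IsMacdonaldFamily.eq_rogers two_ne_zero RatFunc.X_ne_zero (fun _ => ratFunc_X_pow_ne_one)
    (Classical.epsilon_spec ⟨_, isMacdonaldFamily_rogers two_ne_zero RatFunc.X_ne_zero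
      (fun _ => ratFunc_X_pow_ne_one) k⟩) n

/-- The reduced denominator divides every denominator. -/
theorem eval_denom_div_ne_zero {p d : Polynomial ℂ} {x : ℂ} (hd : d.eval x ≠ 0) :
    (algebraMap (Polynomial ℂ) (RatFunc ℂ) p / algebraMap _ _ d).denom.eval x ≠ 0 := by
  obtain ⟨e, he⟩ := RatFunc.denom_div_dvd p d
  intro h
  rw [he, Polynomial.eval_mul, h, zero_mul] at hd
  exact hd rfl

theorem eval_div {p d : Polynomial ℂ} {x : ℂ} (hd : d.eval x ≠ 0) :
    (algebraMap (Polynomial ℂ) (RatFunc ℂ) p / algebraMap _ _ d).eval (RingHom.id ℂ) x =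
      p.eval x / d.eval x := by
  have hd0 : d ≠ 0 := by rintro rfl; simp at hd
  have h1 := eval_denom_div_ne_zero (p := p) hd
  have h2 := congrArg (Polynomial.eval x) ((RatFunc.num_mul_eq_mul_denom_iff hd0).2
    (rfl : algebraMap (Polynomial ℂ) (RatFunc ℂ) p / algebraMap _ _ d = _))
  rw [Polynomial.eval_mul, Polynomial.eval_mul] at h2
  rw [RatFunc.eval, Polynomial.eval₂_id, Polynomial.eval₂_id, div_eq_div_iff h1 hd, h2]

section Specialization

variable {η : ℂ} {k N : ℕ}

theorem coeff_macdonald_sub {j : ℕ} (hj : j ≤ N) :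
    (macdonald (k + 1) N).coeff ((N : ℤ) - 2 * j) =
      algebraMap (Polynomial ℂ) (RatFunc ℂ) (rogersNum (Polynomial.X ^ 2) k j (N - j)) /
        algebraMap (Polynomial ℂ) (RatFunc ℂ) (rogersNum (Polynomial.X ^ 2) k 0 N) := by
  have h : algebraMap (Polynomial ℂ) (RatFunc ℂ) (Polynomial.X ^ 2) = RatFunc.X ^ 2 := by
    rw [map_pow, RatFunc.algebraMap_X]
  rw [macdonald_eq_rogers, coeff_rogers_sub _ _ hj, map_rogersNum, map_rogersNum, h]

theorem eval_rogersNum (Q : Polynomial ℂ) (a b : ℕ) (x : ℂ) :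
    (rogersNum Q k a b).eval x = rogersNum (Q.eval x) k a b :=
  map_rogersNum (Polynomial.evalRingHom x) Q k a b

theorem macdonaldRegular_of_ne_zero (h : rogersNum (qpow η 1 ^ 2) k 0 N ≠ 0) :
    MacdonaldRegular η (k + 1) N := by
  intro i
  by_cases hi : ∃ j : ℕ, j ≤ N ∧ (N : ℤ) - 2 * j = i
  · obtain ⟨j, hj, rfl⟩ := hi
    rw [coeff_macdonald_sub hj]
    exact eval_denom_div_ne_zero (by simpa [eval_rogersNum] using h)
  · rw [macdonald_eq_rogers, coeff_rogers_eq_zero _ _ fun j hj hji => hi ⟨j, hj, hji⟩]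
    simp

theorem macdonaldValue_eq (h : rogersNum (qpow η 1 ^ 2) k 0 N ≠ 0) (x : ℂ) :
    macdonaldValue η (k + 1) N x = ∑ j ∈ Finset.range (N + 1),
      rogersNum (qpow η 1 ^ 2) k j (N - j) / rogersNum (qpow η 1 ^ 2) k 0 N *
        qpow η ((N - 2 * j) * x) := by
  rw [macdonaldValue]
  rw [Finset.sum_subset (s₂ := (Finset.range (N + 1)).image fun j : ℕ => (N : ℤ) - 2 * j)]
  · rw [Finset.sum_image fun (a : ℕ) _ (b : ℕ) _ (hab : (N : ℤ) - 2 * a = N - 2 * b) => by omega]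
    refine Finset.sum_congr rfl fun j hj => ?_
    rw [coeff_macdonald_sub (Nat.lt_succ_iff.1 (Finset.mem_range.1 hj)),
      eval_div (by simpa [eval_rogersNum] using h)]
    simp [eval_rogersNum]
  · intro i hi
    by_contra hne
    refine Finsupp.mem_support_iff.1 hi ?_
    rw [macdonald_eq_rogers]
    refine coeff_rogers_eq_zero _ _ fun j hj hji => hne ?_
    exact Finset.mem_image.2 ⟨j, Finset.mem_range.2 (by omega), hji⟩
  · intro i _ hi
    rw [Finsupp.notMem_support_iff.1 hi, RatFunc.eval_zero, zero_mul]

end Specialization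

/-! ### The difference of the two values as a finite sum -/

theorem tracePoly_neg (η : ℂ) (k n : ℕ) : tracePoly η k (-n - 1) =
    (tracePoly η k (n - 1)).comp (Polynomial.C (qpow η (2 * n)) * Polynomial.X) := by
  rw [tracePoly, tracePoly, Polynomial.prod_comp]
  refine Finset.prod_congr rfl fun l _ => ?_
  -- After `X ↦ q^(2n) X` the two linear factors of index `l` trade places; the scalars `-p^(l+1)`
  -- and its inverse that arise cancel.
  have e1 : qpow η (-(2 * (-n - 1 - l))) = qpow η (2 * n) * qpow η (2 * (l + 1)) := by
    rw [← qpow_add]; congr 1; ring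
  have e2 : qpow η (-(2 * (n - 1 - l))) * qpow η (2 * n) = qpow η (2 * (l + 1)) := by
    rw [← qpow_add]; congr 1; ring
  have e3 : qpow η (-2) ^ (l + 1) * qpow η (2 * (l + 1)) = 1 := by
    rw [← qpow_nat_mul, ← qpow_add]
    refine Eq.trans ?_ (qpow_zero η)
    congr 1; push_cast; ring
  have c1 := congrArg Polynomial.C e1
  have c2 := congrArg Polynomial.C e2
  have c3 := congrArg Polynomial.C e3
  simp only [Polynomial.C_mul, Polynomial.C_1] at c1 c2 c3
  simp only [Polynomial.mul_comp, Polynomial.sub_comp, Polynomial.X_comp, Polynomial.C_comp,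
    Polynomial.one_comp]
  rw [c1]
  set a := Polynomial.C (qpow η (-2) ^ (l + 1))
  set b := Polynomial.C (qpow η (2 * ((l : ℂ) + 1)))
  set c := Polynomial.C (qpow η (2 * (n : ℂ)))
  set X : Polynomial ℂ := Polynomial.X
  linear_combination (c * X - X) * c3 + (c * X ^ 2 - a * X) * c2

theorem prod_eq_rogersNum (η : ℂ) (k N : ℕ) {i : ℕ} (hi : i ≤ N) :
    ∏ l ∈ Finset.range k, ((1 - qpow η (-2) ^ (l + 1) * qpow η (-2) ^ i) *
        (1 - qpow η (-(2 * ((N + k + 1 : ℕ) - 1 - l))) * qpow η (-2) ^ (-i : ℤ))) =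
      rogersNum (qpow η (-2)) k i (N - i) := by
  rw [rogersNum, Finset.prod_mul_distrib, Finset.prod_mul_distrib,
    ← Finset.prod_range_reflect (fun l => 1 - qpow η (-(2 * ((N + k + 1 : ℕ) - 1 - l))) *
      qpow η (-2) ^ (-i : ℤ))]
  congr 1
  · exact Finset.prod_congr rfl fun l _ => by rw [← pow_add]; ring_nf
  · refine Finset.prod_congr rfl fun l hl => ?_
    have hl := Finset.mem_range.1 hl
    rw [← qpow_int_mul, ← qpow_nat_mul, ← qpow_add, show k - 1 - l = k - (1 + l) by omega,
      Nat.cast_sub (by omega)]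
    congr 2
    push_cast [hi]
    ring

/-- By `tracePoly_neg` each pair of fractions combines to `(1 - x^n) / (1 - x)` with `x =
q^(2(s-k-ν))`, a geometric sum of `n` terms. -/
theorem explicitTrace_sub_explicitTrace {η ν : ℂ} {k : ℕ} (hν : ν ∈ regularDomain η k) (N : ℕ) :
    explicitTrace η k ((N + k + 1 : ℕ) - 1) ν - explicitTrace η k (-(N + k + 1 : ℕ) - 1) ν =
      qpow η ((ν + k) * N) / (∏ l ∈ Finset.range k, (1 - qpow η (-2) ^ (l + 1))) *
        ∑ j ∈ Finset.range (N + 1), rogersNum (qpow η (-2)) k j (N - j) *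
          qpow η (-(2 * ν)) ^ j := by
  set n := N + k + 1 with hn
  have e1 : (ν + k) * ((n : ℂ) - 1 - k) = (ν + k) * N := by rw [hn]; push_cast; ring
  have e2 : (ν + k) * (-(n : ℂ) - 1 - k) = (ν + k) * N + -(2 * n * (ν + k)) := by
    rw [hn]; push_cast; ring
  have h1 : ∀ s ∈ Finset.range (2 * k + 1),
      (tracePoly η k (n - 1)).coeff s * (1 - qpow η (2 * (s - k - ν)))⁻¹ -
        qpow η (-(2 * n * (ν + k))) * ((tracePoly η k (-n - 1)).coeff s *
          (1 - qpow η (2 * (s - k - ν)))⁻¹) =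
      ∑ i ∈ Finset.range n, (tracePoly η k (n - 1)).coeff s * qpow η (2 * (s - k - ν)) ^ i := by
    intro s hs
    have h2 := mul_neg_geom_sum (qpow η (2 * (s - k - ν))) n
    have h3 := one_sub_qpow_ne_zero η k hν hs
    have h4 : qpow η (-(2 * n * (ν + k))) * qpow η (2 * n) ^ s =
        qpow η (2 * (s - k - ν)) ^ n := by
      rw [← qpow_nat_mul, ← qpow_nat_mul, ← qpow_add]; congr 1; ring
    rw [tracePoly_neg, Polynomial.comp_C_mul_X_coeff, ← Finset.mul_sum]
    rw [← sub_eq_zero, ← mul_right_inj' h3, mul_zero]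
    field_simp
    linear_combination (-(tracePoly η k (n - 1)).coeff s) * (h2 + h4)
  have h5 := Finset.sum_congr rfl h1
  rw [Finset.sum_sub_distrib, ← Finset.mul_sum, Finset.sum_comm] at h5
  simp only [sum_tracePoly_coeff_mul_pow] at h5
  have h6 : ∑ j ∈ Finset.range (N + 1), rogersNum (qpow η (-2)) k j (N - j) *
      qpow η (-(2 * ν)) ^ j = ∑ i ∈ Finset.range n, (∏ l ∈ Finset.range k,
        ((1 - qpow η (-2) ^ (l + 1) * qpow η (-2) ^ i) *
          (1 - qpow η (-(2 * (n - 1 - l))) * qpow η (-2) ^ (-i : ℤ)))) *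
        qpow η (-(2 * ν)) ^ i := by
    refine Eq.trans (Finset.sum_congr rfl fun i hi => ?_)
      (Finset.sum_subset (Finset.range_mono (by omega)) fun i hi hi' => ?_)
    · rw [hn, prod_eq_rogersNum η k N (Nat.lt_succ_iff.1 (Finset.mem_range.1 hi))]
    · have hi := Finset.mem_range.1 hi
      have hi' : N < i := by simpa [Nat.lt_succ_iff] using hi'
      -- For `N < i < n` the second factor of index `l = n - 1 - i` is zero.
      rw [Finset.prod_eq_zero (i := n - 1 - i) (Finset.mem_range.2 (by omega)), zero_mul]
      rw [← qpow_int_mul, ← qpow_add, Nat.cast_sub (by omega), Nat.cast_sub (by omega)]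
      rw [show -(2 * ((n : ℂ) - 1 - ((n : ℂ) - (1 : ℕ) - i))) + ((-i : ℤ) : ℂ) * -2 = 0 by
        push_cast; ring, qpow_zero, sub_self, mul_zero]
  rw [explicitTrace, explicitTrace, e1, e2, qpow_add, h6]
  linear_combination (qpow η ((ν + k) * N) /
    ∏ l ∈ Finset.range k, (1 - qpow η (-2) ^ (l + 1))) * h5

/-! ### Specialization to `q = e^(πi/κ)` -/

theorem dvd_of_qpow_eq_one {κ : ℕ} (hκ : κ ≠ 0) {η : ℂ} (hη : η = Real.pi * Complex.I / κ)
    {j : ℤ} (h : qpow η (2 * j) = 1) : (κ : ℤ) ∣ j := by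
  obtain ⟨n, hn⟩ := Complex.exp_eq_one_iff.1 h
  refine ⟨n, ?_⟩
  have h1 : (κ : ℂ) ≠ 0 := Nat.cast_ne_zero.2 hκ
  have h2 : (Real.pi : ℂ) ≠ 0 := Complex.ofReal_ne_zero.2 Real.pi_ne_zero
  rw [hη] at hn
  field_simp at hn
  exact_mod_cast hn

theorem qpow_two_mul_ne_one {κ : ℕ} {η : ℂ} (hη : η = Real.pi * Complex.I / κ)
    {j : ℤ} (h0 : 0 < j) (h1 : j < κ) : qpow η (2 * j) ≠ 1 := fun h => by
  have := Int.le_of_dvd h0 (dvd_of_qpow_eq_one (by omega) hη h)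
  omega

theorem qpow_neg_left (η x : ℂ) : qpow (-η) x = qpow η (-x) := by
  simp [qpow]

/-- Each factor is `q^(-n+2j) (1 - q^(2(n-j)))` with `n = N + k + 1`, and the extracted exponents
add up to `-kN`. -/
theorem prod_qpow_sub_qpow (η : ℂ) (k N : ℕ) :
    ∏ j ∈ Finset.Icc 1 k, (qpow η (-(N + k + 1 : ℕ) + 2 * j) - qpow η (N + k + 1 : ℕ)) =
      qpow η (-(k * N)) * ∏ l ∈ Finset.range k, (1 - qpow η 2 ^ (N + l + 1)) := by
  have h : ∀ (n : ℂ) (k : ℕ), ∏ l ∈ Finset.range k, qpow η (-n + 2 * (l + 1 : ℕ)) =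
      qpow η (k * (-n + k + 1)) := by
    intro n k
    induction k with
    | zero => simp [qpow_zero]
    | succ k ih => rw [Finset.prod_range_succ, ih, ← qpow_add]; congr 1; push_cast; ring
  rw [prod_Icc_one_eq_prod_range, ← Finset.prod_range_reflect (fun l => 1 - qpow η 2 ^ (N + l + 1)),
    show (-(k * N) : ℂ) = k * (-(N + k + 1 : ℕ) + k + 1) by push_cast; ring, ← h,
    ← Finset.prod_mul_distrib]
  refine Finset.prod_congr rfl fun l hl => ?_
  have hl := Finset.mem_range.1 hl
  rw [mul_sub, mul_one, ← qpow_nat_mul, ← qpow_add,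
    show N + (k - 1 - l) + 1 = N + k + 1 - (l + 1) by omega, Nat.cast_sub (by omega)]
  congr 2
  ring

end QuantumTrace

end

theorem mainTheorem10 (κ k p n : ℕ) (m : ℤ) (hκ : 2 * k + 2 ≤ κ) (hn : k + 1 ≤ n) (hnκ : n ≤ κ)
    (hm : -(p : ℤ) + 2 * k + 1 ≤ m) (hmκ : m ≤ (κ : ℤ) - p - 1)
    (η : ℂ) (hη : η = Real.pi * Complex.I / κ) :
    QuantumTrace.MacdonaldRegular η (k + 1) (n - k - 1) ∧
      QuantumTrace.renormalizedTrace (-η) k (-m - p + k) (n - 1) -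
          QuantumTrace.renormalizedTrace (-η) k (-m - p + k) (-n - 1) =
        QuantumTrace.macdonaldValue η (k + 1) (n - k - 1) (m + p - k) *
          ∏ j ∈ Finset.Icc 1 k,
            (QuantumTrace.qpow η (-n + 2 * j) - QuantumTrace.qpow η n) := by
  open QuantumTrace in
  obtain ⟨N, rfl⟩ : ∃ N, n = N + k + 1 := ⟨n - k - 1, by omega⟩
  rw [show N + k + 1 - k - 1 = N by omega]
  have hpow : ∀ j : ℕ, 0 < j → j < κ → 1 - qpow η 2 ^ j ≠ 0 := fun j h0 h1 => by
    have := qpow_two_mul_ne_one hη (j := j) (by omega) (by omega)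
    rw [← qpow_nat_mul, mul_comm]
    exact sub_ne_zero.2 (by simpa using this.symm)
  have hq : qpow η 1 ^ 2 = qpow η 2 := by rw [← qpow_nat_mul]; norm_num
  have hP : ∏ l ∈ Finset.range k, (1 - qpow η 2 ^ (l + 1)) ≠ 0 :=
    Finset.prod_ne_zero_iff.2 fun l hl =>
      hpow _ (by omega) (by have := Finset.mem_range.1 hl; omega)
  -- The exponents in the denominator are at most `N + k = n - 1 < κ`.
  have hr : rogersNum (qpow η 2) k 0 N ≠ 0 := Finset.prod_ne_zero_iff.2 fun l hl => by
    have := Finset.mem_range.1 hl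
    exact mul_ne_zero (hpow _ (by omega) (by omega)) (hpow _ (by omega) (by omega))
  refine ⟨macdonaldRegular_of_ne_zero (by rwa [hq]), ?_⟩
  have hη0 : -η ≠ 0 := by
    rw [hη, neg_ne_zero]
    have : (κ : ℂ) ≠ 0 := Nat.cast_ne_zero.2 (by omega)
    exact div_ne_zero (mul_ne_zero (Complex.ofReal_ne_zero.2 Real.pi_ne_zero) Complex.I_ne_zero)
      this
  have hre : (-η).re = 0 := by
    rw [hη, ← Complex.ofReal_natCast]; simp
  have hk : ∀ j : ℕ, 1 ≤ j → j ≤ 2 * k → qpow (-η) (2 * j) ≠ 1 := by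
    intro j h1 h2 h
    refine qpow_two_mul_ne_one hη (j := j) (by omega) (by omega) ?_
    rw [qpow_neg_left, qpow_neg, inv_eq_one] at h
    simpa using h
  -- The bounds on `m` say precisely that `m + p - k + l` stays between `1` and `κ - 1` for `|l| ≤
  -- k`.
  have hν : (-m - p + k : ℂ) ∈ regularDomain (-η) k := by
    intro l hl
    rw [abs_le] at hl
    have := qpow_two_mul_ne_one hη (j := m + p - k + l) (by omega) (by omega)
    rw [qpow_neg_left]
    convert this using 2
    push_cast; ring
  rw [renormalizedTrace_eq hη0 hre hk hν, renormalizedTrace_eq hη0 hre hk hν,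
    explicitTrace_sub_explicitTrace hν, macdonaldValue_eq (by rwa [hq]), prod_qpow_sub_qpow, hq,
    Finset.sum_mul, Finset.mul_sum]
  refine Finset.sum_congr rfl fun j _ => ?_
  -- The first half is the denominator in the trace function; the second cancels against the product
  -- on the right of the theorem.
  have e1 : rogersNum (qpow η 2) k 0 N = (∏ l ∈ Finset.range k, (1 - qpow η 2 ^ (l + 1))) *
      ∏ l ∈ Finset.range k, (1 - qpow η 2 ^ (N + l + 1)) := by
    rw [rogersNum, Finset.prod_mul_distrib]; simp
  have e2 : qpow η ((N - 2 * j) * (m + p - k)) * qpow η (-(k * N)) =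
      qpow (-η) ((-m - p + k + k) * N) * qpow (-η) (-(2 * (-m - p + k))) ^ j := by
    rw [qpow_neg_left, qpow_neg_left, ← qpow_nat_mul, ← qpow_add, ← qpow_add]
    congr 1; ring
  have e3 : qpow (-η) (-2) = qpow η 2 := by rw [qpow_neg_left, neg_neg]
  rw [e1, mul_ne_zero_iff] at hr
  rw [e3, e1]
  set t := qpow (-η) (-(2 * (-m - p + k))) ^ j
  have h2 := hr.2
  field_simp
  linear_combination (-rogersNum (qpow η 2) k j (N - j)) * e2
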